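/- Fix an integer base $b\ge 2$ and let $A_b=\{0,1,\dots,b-1\}$. The value of a word $u=a_0a_1\cdots a_k\in A_b^*$, read least significant digit first, is $\overline{u}=\sum_{i=0}^k a_i b^i$. A complete deterministic finite automaton (DFA) $\mathcal A$ over $A_b$ is minimal if every state is reachable from the initial state and distinct states accept distinct languages. It accepts the set of numbers $E\subseteq\mathbb N$ if, for every word $u\in A_b^*$, $u$ is accepted by $\mathcal A$ if and only if $\overline{u}\in E$. A set $E\subseteq\mathbb N$ is ultimately periodic if there are $m\ge 0$ and $p\ge 1$ such that, for all $n\ge m$, $n\in E$ if and only if $n+p\in E$. Theorem. For every fixed $b\ge 2$ it is decidable in linear time whether a given minimal DFA over $A_b$ accepts an ultimately periodic set of numbers. That is, there are a program for a unit-cost random access machine (with addition, truncated subtraction, comparison and indirect addressing as its operations) and a constant $C$, both depending only on $b$, such that for every $n$ and every minimal DFA $\mathcal A$ over $A_b$ with $n$ states, given by its transition table, its initial state and the table of its final states, the program halts after at most $Cn$ steps, never handling a number larger than $Cn$, and outputs $1$ if $\mathcal A$ accepts an ultimately periodic set of numbers and $0$ otherwise. -/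

import Mathlib

/-! ### Numbers in base `b`, ultimately periodic sets, minimal automata -/

/-- The value of a word over the digit alphabet `{0, …, b - 1}`, least significant digit first:
the value of `a₀ a₁ ⋯ aₖ` is `∑ aᵢ bⁱ`. -/
def wordValue {b : ℕ} (w : List (Fin b)) : ℕ :=
  Nat.ofDigits b (w.map Fin.val)

/-- A set of natural numbers that is periodic, of some period `p ≥ 1`, from some point on. -/
def UltimatelyPeriodic (E : Set ℕ) : Prop :=
  ∃ m p : ℕ, 0 < p ∧ ∀ n, m ≤ n → (n + p ∈ E ↔ n ∈ E)

/-- A (complete) deterministic automaton is minimal if it is accessible, and reduced: distinct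
states accept distinct languages. -/
def IsMinimalDFA {α σ : Type*} (M : DFA α σ) : Prop :=
  (∀ q, ∃ w, M.eval w = q) ∧ Function.Injective M.acceptsFrom

/-- The numbers accepted by an automaton: the values of the accepted words. -/
def acceptedNumbers {b : ℕ} {σ : Type*} (M : DFA (Fin b) σ) : Set ℕ :=
  {n | ∃ w ∈ M.accepts, wordValue w = n}

/-- The automaton accepts an ultimately periodic set of numbers: acceptance of a word depends
only on its value (of each number, all representations are accepted or none is), and the set of
the accepted numbers is ultimately periodic. -/
def AcceptsUPSet {b : ℕ} {σ : Type*} (M : DFA (Fin b) σ) : Prop :=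
  (∀ w, w ∈ M.accepts ↔ wordValue w ∈ acceptedNumbers M) ∧
    UltimatelyPeriodic (acceptedNumbers M)

/-! ### A random access machine with bounded words -/

namespace RAM

/-- A memory state: registers, and arrays with random access. Both are numbered by `ℕ`; a program
mentions only finitely many of them. -/
structure Store where
  reg : ℕ → ℕ
  arr : ℕ → ℕ → ℕ

/-- Put the value `v` in the register `x`. -/
def Store.setReg (s : Store) (x v : ℕ) : Store :=
  { s with reg := Function.update s.reg x v }

/-- Put the value `v` in the cell `i` of the array `j`. -/
def Store.setArr (s : Store) (j i v : ℕ) : Store :=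
  { s with arr := Function.update s.arr j (Function.update (s.arr j) i v) }

/-- The elementary instructions; `x`, `y`, `z` are register numbers, `j` is an array number.
The only arithmetic operations are addition and truncated subtraction. -/
inductive Instr where
  /-- `x := k`, for a constant `k` -/
  | const (x k : ℕ)
  /-- `x := y` -/
  | copy (x y : ℕ)
  /-- `x := y + z` -/
  | add (x y z : ℕ)
  /-- `x := max (y - z) 0` -/
  | sub (x y z : ℕ)
  /-- `x := arr j [y]` -/
  | load (x j y : ℕ)
  /-- `arr j [x] := y` -/
  | store (j x y : ℕ)

/-- Programs: instructions, composed sequentially, by conditionals and by loops. -/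
inductive Prog where
  | skip
  | instr (i : Instr)
  | seq (P Q : Prog)
  /-- `if x < y then P else Q` -/
  | ifLt (x y : ℕ) (P Q : Prog)
  /-- `while x < y do P` -/
  | whileLt (x y : ℕ) (P : Prog)

/-- The effect of one instruction when a machine word holds the numbers `0, …, W`: an operation
whose result exceeds `W` is an overflow and the machine is stuck (`none`). -/
def Instr.run (W : ℕ) (s : Store) : Instr → Option Store
  | .const x k => if k ≤ W then some (s.setReg x k) else none
  | .copy x y => some (s.setReg x (s.reg y))
  | .add x y z => if s.reg y + s.reg z ≤ W then some (s.setReg x (s.reg y + s.reg z)) else none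
  | .sub x y z => some (s.setReg x (s.reg y - s.reg z))
  | .load x j y => some (s.setReg x (s.arr j (s.reg y)))
  | .store j x y => some (s.setArr j (s.reg x) (s.reg y))

/-- `Exec W P s s' t`: with words bounded by `W`, the program `P` started in `s` halts in `s'`,
without overflow, after exactly `t` steps. Every executed instruction and every evaluated test is
one step. -/
inductive Exec (W : ℕ) : Prog → Store → Store → ℕ → Prop where
  | skip (s : Store) : Exec W .skip s s 0
  | instr {i : Instr} {s s' : Store} (h : i.run W s = some s') : Exec W (.instr i) s s' 1
  | seq {P Q : Prog} {s s' s'' : Store} {t t' : ℕ} (hP : Exec W P s s' t)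
      (hQ : Exec W Q s' s'' t') : Exec W (.seq P Q) s s'' (t + t')
  | ifTrue {x y : ℕ} {P Q : Prog} {s s' : Store} {t : ℕ} (h : s.reg x < s.reg y)
      (hP : Exec W P s s' t) : Exec W (.ifLt x y P Q) s s' (t + 1)
  | ifFalse {x y : ℕ} {P Q : Prog} {s s' : Store} {t : ℕ} (h : ¬ s.reg x < s.reg y)
      (hQ : Exec W Q s s' t) : Exec W (.ifLt x y P Q) s s' (t + 1)
  | whileTrue {x y : ℕ} {P : Prog} {s s' s'' : Store} {t t' : ℕ} (h : s.reg x < s.reg y)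
      (hP : Exec W P s s' t) (hL : Exec W (.whileLt x y P) s' s'' t') :
      Exec W (.whileLt x y P) s s'' (t + t' + 1)
  | whileFalse {x y : ℕ} {P : Prog} {s : Store} (h : ¬ s.reg x < s.reg y) :
      Exec W (.whileLt x y P) s s 1

/-- The machine is deterministic: the result and the number of steps are unique. -/
theorem Exec.deterministic {W : ℕ} {P : Prog} {s s₁ s₂ : Store} {t₁ t₂ : ℕ}
    (h₁ : Exec W P s s₁ t₁) (h₂ : Exec W P s s₂ t₂) : s₁ = s₂ ∧ t₁ = t₂ := by
  induction h₁ generalizing s₂ t₂ with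
  | skip s => cases h₂; exact ⟨rfl, rfl⟩
  | instr h =>
    cases h₂ with
    | instr h' => rw [h] at h'; exact ⟨Option.some.inj h', rfl⟩
  | seq _ _ ihP ihQ =>
    cases h₂ with
    | seq hP hQ =>
      obtain ⟨rfl, rfl⟩ := ihP hP
      obtain ⟨rfl, rfl⟩ := ihQ hQ
      exact ⟨rfl, rfl⟩
  | ifTrue h _ ih =>
    cases h₂ with
    | ifTrue _ hP => obtain ⟨rfl, rfl⟩ := ih hP; exact ⟨rfl, rfl⟩
    | ifFalse h' _ => exact absurd h h'
  | ifFalse h _ ih =>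
    cases h₂ with
    | ifTrue h' _ => exact absurd h' h
    | ifFalse _ hQ => obtain ⟨rfl, rfl⟩ := ih hQ; exact ⟨rfl, rfl⟩
  | whileTrue h _ _ ihP ihL =>
    cases h₂ with
    | whileTrue _ hP hL =>
      obtain ⟨rfl, rfl⟩ := ihP hP
      obtain ⟨rfl, rfl⟩ := ihL hL
      exact ⟨rfl, rfl⟩
    | whileFalse h' => exact absurd h h'
  | whileFalse h =>
    cases h₂ with
    | whileTrue h' _ _ => exact absurd h' h
    | whileFalse _ => exact ⟨rfl, rfl⟩

open Classical in
/-- The initial memory for the automaton `M` with states `0, …, n - 1` over the digits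
`0, …, b - 1`: register `0` holds `n`, register `1` the initial state; for each digit `a`, the
array `a` is the table of the successors by `a`; the array `b` is the table of the final states
(`1` for final, `0` for non-final). Everything else is `0`. -/
noncomputable def input {b n : ℕ} (M : DFA (Fin b) (Fin n)) : Store where
  reg x := if x = 0 then n else if x = 1 then (M.start : ℕ) else 0
  arr j i :=
    if hi : i < n then
      if hj : j < b then (M.step ⟨i, hi⟩ ⟨j, hj⟩ : ℕ)
      else if j = b ∧ (⟨i, hi⟩ : Fin n) ∈ M.accept then 1 else 0
    else 0

end RAM

/-! ### Sets of numbers accepted from the states of an automaton -/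

/-! Write E_q for the set of numbers accepted from the state q. Reading the digit a replaces E_q by
{m : a + b m ∈ E_q}. Acceptance depends on values only exactly when finality is insensitive to the
digit zero (`ZeroStable`), and then, in a reduced automaton, states with equal sets E_q are equal.

Suppose that the automaton accepts an ultimately periodic set; then every E_q is ultimately
periodic. Going around a cycle many times dilates numbers by a large power of b, which pushes every
n ≥ 1 past the preperiod and absorbs the part of the period that shares factors with b. So on a
cycle E_q is, apart from the number 0, periodic with a period p prime to b
(`ZeroStable.coprimePeriodic_of_onCycle`), and this property passes to successors. For such q some
power b^(k+1) is 1 modulo p. Hence 0^(k+1) leads from q back to q, and 1 0^k leads to a state T q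
with E_(T q) = {n : n + 1 ∈ E_q}. As zero acts injectively on these states, T q is the unique one
whose successor by 0 is the successor of q by 1, so T can be read off the transition table. Adding
one with carry then forces the identities in `ShiftCompatible`.

Conversely, these identities alone give n + 1 ∈ E_q ↔ n ∈ E_(T q) by induction on n. So n ∈ E_q iff
T^n q is final, and orbits of a self-map of a finite set are ultimately periodic. The states that no
cycle leads to inherit ultimate periodicity from their successors, in reverse topological order.
Both directions meet in `IsMinimalDFA.acceptsUPSet_iff`.

Each condition is local: a topological sort by indegrees finds the states to discard, one pass
inverts the digit zero, and one pass compares O(b) table entries per state. All this is linear in n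
for fixed b. -/

theorem wordValue_nil {b : ℕ} : wordValue ([] : List (Fin b)) = 0 := rfl

theorem wordValue_cons {b : ℕ} (a : Fin b) (w : List (Fin b)) :
    wordValue (a :: w) = a + b * wordValue w := by
  simp [wordValue, Nat.ofDigits_cons]

theorem exists_wordValue_eq {b : ℕ} (hb : 2 ≤ b) (n : ℕ) : ∃ w : List (Fin b), wordValue w = n := by
  induction n using Nat.strong_induction_on with
  | _ n ih =>
    rcases Nat.eq_zero_or_pos n with rfl | hn
    · exact ⟨[], rfl⟩
    · obtain ⟨w, hw⟩ := ih (n / b) (Nat.div_lt_self hn (by omega))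
      exact ⟨⟨n % b, Nat.mod_lt _ (by omega)⟩ :: w, by
        rw [wordValue_cons, hw]; exact Nat.mod_add_div n b⟩

theorem digit_eq_of_add_mul_eq {b : ℕ} {a a' : Fin b} {m m' : ℕ}
    (h : (a : ℕ) + b * m = a' + b * m') : a = a' ∧ m = m' := by
  have h1 : (a : ℕ) = a' := by
    have := congrArg (· % b) h
    simpa [Nat.add_mul_mod_self_left, Nat.mod_eq_of_lt] using this
  have hb : 0 < b := a.pos
  refine ⟨Fin.ext h1, ?_⟩
  rw [h1] at h
  exact Nat.eq_of_mul_eq_mul_left hb (Nat.add_left_cancel h)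

/-- The numbers accepted from the state `q`. -/
def numbersFrom {b : ℕ} {σ : Type*} (M : DFA (Fin b) σ) (q : σ) : Set ℕ :=
  {n | ∃ w ∈ M.acceptsFrom q, wordValue w = n}

/-- The final states are stable, in both directions, under the digit zero. -/
def ZeroStable {b : ℕ} {σ : Type*} (M : DFA (Fin b) σ) : Prop :=
  ∀ (q : σ) (a : Fin b), (a : ℕ) = 0 → (q ∈ M.accept ↔ M.step q a ∈ M.accept)

section

variable {b : ℕ} {σ : Type*} {M : DFA (Fin b) σ}

theorem nil_mem_acceptsFrom {q : σ} : [] ∈ M.acceptsFrom q ↔ q ∈ M.accept := Iff.rfl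

theorem cons_mem_acceptsFrom {q : σ} {a : Fin b} {w : List (Fin b)} :
    a :: w ∈ M.acceptsFrom q ↔ w ∈ M.acceptsFrom (M.step q a) := Iff.rfl

theorem ZeroStable.mem_acceptsFrom_of_wordValue_eq_zero (h : ZeroStable M) {w : List (Fin b)}
    (hw : wordValue w = 0) (q : σ) : w ∈ M.acceptsFrom q ↔ q ∈ M.accept := by
  induction w generalizing q with
  | nil => exact Iff.rfl
  | cons a w ih =>
    rw [wordValue_cons] at hw
    have hb : b ≠ 0 := a.pos.ne'
    have ha : (a : ℕ) = 0 := by omega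
    have hw' : wordValue w = 0 := by
      rcases Nat.mul_eq_zero.1 (show b * wordValue w = 0 by omega) with h | h
      · exact absurd h hb
      · exact h
    rw [cons_mem_acceptsFrom, ih hw', ← h q a ha]

/-- Two words of equal value agree digit by digit until one of them ends; the rest of the other
consists of zeros, which do not affect finality. -/
theorem ZeroStable.mem_acceptsFrom_congr (h : ZeroStable M) {w w' : List (Fin b)}
    (hw : wordValue w = wordValue w') (q : σ) :
    w ∈ M.acceptsFrom q ↔ w' ∈ M.acceptsFrom q := by
  induction w generalizing q w' with
  | nil => rw [h.mem_acceptsFrom_of_wordValue_eq_zero hw.symm, nil_mem_acceptsFrom]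
  | cons a u ih =>
    cases w' with
    | nil => rw [h.mem_acceptsFrom_of_wordValue_eq_zero hw, nil_mem_acceptsFrom]
    | cons a' u' =>
      rw [wordValue_cons, wordValue_cons] at hw
      obtain ⟨rfl, h2⟩ := digit_eq_of_add_mul_eq hw
      rw [cons_mem_acceptsFrom, cons_mem_acceptsFrom, ih h2]

theorem ZeroStable.mem_acceptsFrom_iff (h : ZeroStable M) {q : σ} {w : List (Fin b)} :
    w ∈ M.acceptsFrom q ↔ wordValue w ∈ numbersFrom M q := by
  refine ⟨fun hw => ⟨w, hw, rfl⟩, ?_⟩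
  rintro ⟨w', hw', e⟩
  exact (h.mem_acceptsFrom_congr e q).1 hw'

theorem ZeroStable.zero_mem_numbersFrom (h : ZeroStable M) {q : σ} :
    0 ∈ numbersFrom M q ↔ q ∈ M.accept := by
  rw [← nil_mem_acceptsFrom, h.mem_acceptsFrom_iff, wordValue_nil]

theorem ZeroStable.add_mul_mem (h : ZeroStable M) (hb : 2 ≤ b) {q : σ} (a : Fin b) (m : ℕ) :
    (a : ℕ) + b * m ∈ numbersFrom M q ↔ m ∈ numbersFrom M (M.step q a) := by
  obtain ⟨u, rfl⟩ := exists_wordValue_eq hb m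
  rw [← wordValue_cons, ← h.mem_acceptsFrom_iff, ← h.mem_acceptsFrom_iff, cons_mem_acceptsFrom]

theorem ZeroStable.wordValue_add_mem (h : ZeroStable M) (hb : 2 ≤ b) (w : List (Fin b)) (q : σ)
    (m : ℕ) :
    wordValue w + b ^ w.length * m ∈ numbersFrom M q ↔ m ∈ numbersFrom M (M.evalFrom q w) := by
  induction w generalizing q with
  | nil => simp [wordValue_nil]
  | cons a w ih =>
    rw [DFA.evalFrom_cons, ← ih, ← h.add_mul_mem hb, wordValue_cons, List.length_cons]
    ring_nf

/-- This turns reducedness into a tool for arithmetic: every equality of states below is proved by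
comparing sets of numbers. -/
theorem ZeroStable.numbersFrom_injective (h : ZeroStable M)
    (hM : Function.Injective M.acceptsFrom) : Function.Injective (numbersFrom M) := by
  intro q q' e
  apply hM
  ext w
  rw [h.mem_acceptsFrom_iff, h.mem_acceptsFrom_iff, e]

/-! ### Ultimately periodic sets -/

theorem add_mul_mem_iff_of_periodic {E : Set ℕ} {m p : ℕ}
    (h : ∀ n, m ≤ n → (n + p ∈ E ↔ n ∈ E)) {n : ℕ} (hn : m ≤ n) (k : ℕ) :
    n + k * p ∈ E ↔ n ∈ E := by
  induction k with
  | zero => simp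
  | succ k ih => rw [← ih, ← h (n + k * p) (by omega)]; ring_nf

theorem ZeroStable.ultimatelyPeriodic_evalFrom (h : ZeroStable M) (hb : 2 ≤ b) {q : σ}
    (hq : UltimatelyPeriodic (numbersFrom M q)) (w : List (Fin b)) :
    UltimatelyPeriodic (numbersFrom M (M.evalFrom q w)) := by
  obtain ⟨m, p, hp, H⟩ := hq
  refine ⟨m, p, hp, fun n hn => ?_⟩
  rw [← h.wordValue_add_mem hb, ← h.wordValue_add_mem hb, mul_add, ← add_assoc]
  refine add_mul_mem_iff_of_periodic H ?_ _
  have : 1 * n ≤ b ^ w.length * n := Nat.mul_le_mul_right _ (Nat.one_le_pow _ _ (by omega))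
  omega

/-- The set is the disjoint union, over the residues modulo b, of dilated copies of the successors'
sets; a common multiple of their periods, times b, serves all residues. -/
theorem ZeroStable.ultimatelyPeriodic_of_step (h : ZeroStable M) (hb : 2 ≤ b) {q : σ}
    (hq : ∀ a, UltimatelyPeriodic (numbersFrom M (M.step q a))) :
    UltimatelyPeriodic (numbersFrom M q) := by
  choose m p hp H using hq
  refine ⟨b * ∑ a, m a, b * ∏ a, p a,
    Nat.mul_pos (by omega) (Finset.prod_pos fun a _ => hp a), fun n hn => ?_⟩
  set a : Fin b := ⟨n % b, Nat.mod_lt _ (by omega)⟩ with ha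
  have hn' : n = a + b * (n / b) := (Nat.mod_add_div n b).symm
  obtain ⟨c, hc⟩ : p a ∣ ∏ a, p a := Finset.dvd_prod_of_mem p (Finset.mem_univ a)
  have hle : m a ≤ n / b := by
    rw [Nat.le_div_iff_mul_le (by omega), mul_comm]
    exact (Nat.mul_le_mul_left _ (Finset.single_le_sum (fun _ _ => Nat.zero_le _)
      (Finset.mem_univ a))).trans hn
  rw [hn', add_assoc, ← mul_add, h.add_mul_mem hb, h.add_mul_mem hb, hc, mul_comm]
  exact add_mul_mem_iff_of_periodic (H a) hle c

/-! ### Periods prime to the base -/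

theorem exists_coprime_dvd_pow_mul (b : ℕ) {p : ℕ} (hp : 0 < p) :
    ∃ r e, 0 < r ∧ r.Coprime b ∧ p ∣ b ^ e * r := by
  induction p using Nat.strong_induction_on with
  | _ p ih =>
    by_cases hc : p.Coprime b
    · exact ⟨p, 0, hp, hc, by simp⟩
    -- Divide out gcd(p, b) > 1, which costs one factor b, and recurse on the smaller quotient.
    · obtain ⟨p', hp'⟩ := Nat.gcd_dvd_left p b
      have hg : 0 < p.gcd b := Nat.gcd_pos_of_pos_left _ hp
      have hg1 : 1 < p.gcd b := by
        have : p.gcd b ≠ 1 := hc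
        omega
      have hpos : 0 < p' := by
        rcases Nat.eq_zero_or_pos p' with h0 | h0
        · rw [h0, mul_zero] at hp'; omega
        · exact h0
      have hlt : p' < p := by
        calc p' < p.gcd b * p' := lt_mul_left hpos hg1
          _ = p := hp'.symm
      obtain ⟨r, e, hr, hrc, hd⟩ := ih p' hlt hpos
      refine ⟨r, e + 1, hr, hrc, ?_⟩
      rw [hp', pow_succ', mul_assoc]
      exact mul_dvd_mul (Nat.gcd_dvd_right p b) hd

/-- A state on a cycle. -/
def OnCycle (M : DFA (Fin b) σ) (q : σ) : Prop := ∃ w, w ≠ [] ∧ M.evalFrom q w = q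

/-- Up to the number `0`, the numbers accepted from `q` form a periodic set, of a period prime
to the base. -/
def CoprimePeriodic (M : DFA (Fin b) σ) (q : σ) : Prop :=
  ∃ p, 0 < p ∧ p.Coprime b ∧
    ∀ n, 1 ≤ n → (n + p ∈ numbersFrom M q ↔ n ∈ numbersFrom M q)

theorem OnCycle.exists_long {q : σ} (hq : OnCycle M q) (j : ℕ) :
    ∃ w, j ≤ w.length ∧ M.evalFrom q w = q := by
  obtain ⟨u, hu, hq⟩ := hq
  induction j with
  | zero => exact ⟨[], by simp, rfl⟩
  | succ j ih =>
    obtain ⟨w, hw, hq'⟩ := ih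
    have := List.length_pos_of_ne_nil hu
    exact ⟨w ++ u, by simp; omega, by rw [DFA.evalFrom_of_append, hq', hq]⟩

/-- Let p divide b^e r with r prime to b. Along a closed path of length L ≥ e + m, a shift of n by r
becomes a shift by b^L r, a multiple of p. It takes place beyond m because b^L n ≥ m; this needs n ≥
1, hence the exception of the number 0. -/
theorem ZeroStable.coprimePeriodic_of_onCycle (h : ZeroStable M) (hb : 2 ≤ b) {q : σ}
    (hq : OnCycle M q) (hup : UltimatelyPeriodic (numbersFrom M q)) : CoprimePeriodic M q := by
  obtain ⟨m, p, hp, H⟩ := hup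
  obtain ⟨r, e, hr, hrc, hd⟩ := exists_coprime_dvd_pow_mul b hp
  obtain ⟨w, hw, hq⟩ := hq.exists_long (e + m)
  refine ⟨r, hr, hrc, fun n hn => ?_⟩
  have key : p ∣ b ^ w.length * r :=
    hd.trans (mul_dvd_mul_right (pow_dvd_pow b (by omega)) r)
  obtain ⟨c, hc⟩ := key
  rw [← hq, ← h.wordValue_add_mem hb, ← h.wordValue_add_mem hb, mul_add, ← add_assoc, hc,
    mul_comm p c]
  refine add_mul_mem_iff_of_periodic H ?_ _
  have h1 : m ≤ b ^ w.length := by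
    have := Nat.lt_pow_self (n := w.length) (show 1 < b by omega)
    omega
  have h2 : b ^ w.length * 1 ≤ b ^ w.length * n := Nat.mul_le_mul_left _ hn
  omega

theorem wordValue_replicate_zero {a : Fin b} (ha : (a : ℕ) = 0) (k : ℕ) :
    wordValue (List.replicate k a) = 0 := by
  induction k with
  | zero => rfl
  | succ k ih => rw [List.replicate_succ, wordValue_cons, ih, ha, mul_zero, add_zero]

/-- A power of the base that shifts the set accepted from `q` onto itself. -/
theorem CoprimePeriodic.exists_pow (hb : 2 ≤ b) {q : σ} (hq : CoprimePeriodic M q) :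
    ∃ k, ∀ v n, 1 ≤ v + n →
      (v + b ^ (k + 1) * n ∈ numbersFrom M q ↔ v + n ∈ numbersFrom M q) := by
  obtain ⟨p, hp, hc, H⟩ := hq
  -- The exponent is Euler's φ(p). It is positive, so the words built from it below have room for
  -- one letter.
  obtain ⟨k, hk⟩ : ∃ k, p.totient = k + 1 :=
    Nat.exists_eq_succ_of_ne_zero (Nat.totient_pos.2 hp).ne'
  have hmod : 1 ≡ b ^ (k + 1) [MOD p] := by
    rw [← hk]; exact (Nat.ModEq.pow_totient hc.symm).symm
  have hpos : 1 ≤ b ^ (k + 1) := Nat.one_le_pow _ _ (by omega)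
  obtain ⟨c, hcc⟩ := (Nat.modEq_iff_dvd' hpos).1 hmod
  refine ⟨k, fun v n hv => ?_⟩
  have e : v + b ^ (k + 1) * n = v + n + (c * n) * p := by
    rw [show b ^ (k + 1) = 1 + p * c by omega]; ring
  rw [e]
  exact add_mul_mem_iff_of_periodic H hv _

theorem CoprimePeriodic.step (h : ZeroStable M) (hb : 2 ≤ b) {q : σ} (hq : CoprimePeriodic M q)
    (a : Fin b) : CoprimePeriodic M (M.step q a) := by
  obtain ⟨p, hp, hc, H⟩ := hq
  refine ⟨p, hp, hc, fun n hn => ?_⟩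
  rw [← h.add_mul_mem hb, ← h.add_mul_mem hb, mul_add, ← add_assoc]
  refine add_mul_mem_iff_of_periodic H ?_ b
  have : b * 1 ≤ b * n := Nat.mul_le_mul_left _ hn
  omega

theorem CoprimePeriodic.evalFrom (h : ZeroStable M) (hb : 2 ≤ b) {q : σ}
    (hq : CoprimePeriodic M q) (w : List (Fin b)) : CoprimePeriodic M (M.evalFrom q w) := by
  induction w generalizing q with
  | nil => exact hq
  | cons a w ih => exact ih (hq.step h hb a)

/-- In a reduced automaton, a coprime periodic state lies on a cycle of zeros. -/
theorem CoprimePeriodic.exists_replicate (h : ZeroStable M) (hb : 2 ≤ b)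
    (hM : Function.Injective M.acceptsFrom) {q : σ} (hq : CoprimePeriodic M q) {a : Fin b}
    (ha : (a : ℕ) = 0) : ∃ k, M.evalFrom q (List.replicate (k + 1) a) = q := by
  obtain ⟨k, hk⟩ := hq.exists_pow hb
  refine ⟨k, h.numbersFrom_injective hM (Set.ext fun n => ?_)⟩
  -- Both states accept the same numbers: multiplication by b^(k+1) preserves membership for n ≥ 1,
  -- and trivially for n = 0.
  rw [← h.wordValue_add_mem hb, wordValue_replicate_zero ha, List.length_replicate]
  rcases Nat.eq_zero_or_pos n with rfl | hn
  · simp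
  · simpa using hk 0 n (by omega)

/-- In a reduced automaton, the zero digit is injective on the coprime periodic states. -/
theorem CoprimePeriodic.step_zero_injective (h : ZeroStable M) (hb : 2 ≤ b)
    (hM : Function.Injective M.acceptsFrom) {q q' : σ} (hq : CoprimePeriodic M q)
    (hq' : CoprimePeriodic M q') {a : Fin b} (ha : (a : ℕ) = 0)
    (e : M.step q a = M.step q' a) : q = q' := by
  -- Iterating the invariance gives q and q' a common exponent N = (k+1)(k'+1) with n ∈ E ↔ b^N n ∈
  -- E for both sets; membership of b^N n is decided after reading one zero.
  have mem : ∀ {r : σ}, CoprimePeriodic M r → ∃ k, ∀ j n,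
      (n ∈ numbersFrom M r ↔ b ^ (j * (k + 1)) * n ∈ numbersFrom M r) := by
    intro r hr
    obtain ⟨k, hk⟩ := hr.exists_pow hb
    refine ⟨k, fun j n => ?_⟩
    rcases Nat.eq_zero_or_pos n with rfl | hn
    · simp
    induction j with
    | zero => simp
    | succ j ih =>
      have hpos : 0 < b ^ (j * (k + 1)) * n := Nat.mul_pos (Nat.pow_pos (by omega)) hn
      have := hk 0 (b ^ (j * (k + 1)) * n) (by omega)
      rw [zero_add, zero_add, ← mul_assoc, ← pow_add] at this
      rw [ih, ← this, show k + 1 + j * (k + 1) = (j + 1) * (k + 1) by ring]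
  obtain ⟨k, hk⟩ := mem hq
  obtain ⟨k', hk'⟩ := mem hq'
  apply h.numbersFrom_injective hM
  ext n
  have shift : ∀ (r : σ) (N : ℕ), 1 ≤ N →
      (b ^ N * n ∈ numbersFrom M r ↔ b ^ (N - 1) * n ∈ numbersFrom M (M.step r a)) := by
    intro r N hN
    obtain ⟨N, rfl⟩ : ∃ N', N = N' + 1 := ⟨N - 1, by omega⟩
    rw [← h.add_mul_mem hb, ha, zero_add, ← mul_assoc, ← pow_succ', Nat.add_sub_cancel]
  have hN : 1 ≤ (k' + 1) * (k + 1) := Nat.mul_pos (by omega) (by omega)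
  rw [hk (k' + 1), hk' (k + 1), mul_comm (k + 1) (k' + 1), shift q _ hN, shift q' _ hN, e]

/-- From a coprime periodic state, the predecessor set is accepted from some state. -/
theorem CoprimePeriodic.exists_succ (h : ZeroStable M) (hb : 2 ≤ b) {q : σ}
    (hq : CoprimePeriodic M q) :
    ∃ w, ∀ n, (n ∈ numbersFrom M (M.evalFrom q w) ↔ n + 1 ∈ numbersFrom M q) := by
  obtain ⟨k, hk⟩ := hq.exists_pow hb
  -- The word 1 0^k has value 1 and length k + 1, so it leads to {n : 1 + b^(k+1) n ∈ E}, which is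
  -- {n : 1 + n ∈ E}.
  refine ⟨⟨1, by omega⟩ :: List.replicate k ⟨0, by omega⟩, fun n => ?_⟩
  rw [← h.wordValue_add_mem hb, wordValue_cons, wordValue_replicate_zero rfl, List.length_cons,
    List.length_replicate]
  simpa [add_comm] using hk 1 n (by omega)

/-! ### Peeling off the states that no cycle leads to -/

/-- A list of distinct states in which each state comes after all its predecessors. -/
inductive Peeling (M : DFA (Fin b) σ) : List σ → Prop where
  | nil : Peeling M []
  | snoc {l : List σ} {q : σ} (hl : Peeling M l) (hq : q ∉ l)
      (hp : ∀ p a, M.step p a = q → p ∈ l) : Peeling M (l ++ [q])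

theorem Peeling.nodup {l : List σ} (hl : Peeling M l) : l.Nodup := by
  induction hl with
  | nil => exact List.nodup_nil
  | snoc _ hq _ ih =>
    simp only [List.nodup_append, ih, List.nodup_singleton, List.mem_singleton, true_and]
    rintro a ha r hr hra
    exact hq (hr ▸ hra ▸ ha)

theorem Peeling.mem_of_step_mem {l : List σ} (hl : Peeling M l) {p : σ} {a : Fin b}
    (h : M.step p a ∈ l) : p ∈ l := by
  induction hl with
  | nil => simp at h
  | snoc _ _ hp ih =>
    rcases List.mem_append.1 h with h | h
    · exact List.mem_append_left _ (ih h)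
    · exact List.mem_append_left _ (hp p a (by simpa using h))

/-- The last state of a peeling has all its successors outside the list, since the shorter list is
closed under predecessors. So the property spreads backwards, from the last peeled state to the
first. -/
theorem Peeling.induction {l : List σ} (hl : Peeling M l) {P : σ → Prop}
    (hP : ∀ q, (∀ a, P (M.step q a)) → P q) (h : ∀ q, q ∉ l → P q) (q : σ) : P q := by
  induction hl with
  | nil => exact h q (by simp)
  | snoc hl hq hp ih =>
    rename_i l r
    refine ih fun q' hq' => ?_
    by_cases e : q' = r
    · subst e
      refine hP _ fun a => h _ fun hmem => ?_
      rcases List.mem_append.1 hmem with hmem | hmem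
      · exact hq (hl.mem_of_step_mem hmem)
      · exact hq (hp q' a (by simpa using hmem))
    · exact h q' (by simp [hq', e])

theorem Peeling.notMem_of_onCycle {l : List σ} (hl : Peeling M l) {q : σ}
    (hq : OnCycle M q) : q ∉ l := by
  suffices H : ∀ q, ¬ OnCycle M q ∨ q ∉ l by
    rcases H q with h | h
    · exact absurd hq h
    · exact h
  clear hq q
  induction hl with
  | nil => simp
  | snoc hl hr hp ih =>
    rename_i l r
    intro q
    by_contra hcon
    push Not at hcon
    obtain ⟨⟨w, hw, e⟩, hmem⟩ := hcon
    have hcyc : OnCycle M q := ⟨w, hw, e⟩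
    have hql : q ∉ l := (ih q).resolve_left (not_not.2 hcyc)
    have hqr : q = r := by simpa [hql] using hmem
    subst hqr
    rcases List.eq_nil_or_concat w with rfl | ⟨u, a, rfl⟩
    · exact hw rfl
    · rw [List.concat_eq_append, DFA.evalFrom_append_singleton] at e
      -- The last state before the cycle closes is itself on a cycle, by rotation, yet it precedes q
      -- in the peeling.
      have hpl := hp _ _ e
      refine ((ih (M.evalFrom q u)).resolve_left (not_not.2 ⟨a :: u, by simp, ?_⟩)) hpl
      rw [DFA.evalFrom_cons, e]

/-- If each state of a nonempty set of states has a predecessor in the set, then the set contains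
a state on a cycle. -/
theorem exists_onCycle_of_forall_exists_pred [Finite σ] {S : Set σ} (hne : S.Nonempty)
    (h : ∀ q ∈ S, ∃ p ∈ S, ∃ a, M.step p a = q) : ∃ q ∈ S, OnCycle M q := by
  -- Follow chosen predecessors backwards; in a finite set two iterates coincide, and the
  -- transitions between them close a cycle.
  choose g hg a ha using fun q : S => h q q.2
  let f : S → S := fun q => ⟨g q, hg q⟩
  obtain ⟨x, hx⟩ := hne
  have path : ∀ i j, ∃ w, w.length = j ∧
      M.evalFrom (f^[i + j] ⟨x, hx⟩ : S) w = (f^[i] ⟨x, hx⟩ : S) := by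
    intro i j
    induction j with
    | zero => exact ⟨[], rfl, rfl⟩
    | succ j ih =>
      obtain ⟨w, hw, e⟩ := ih
      refine ⟨a (f^[i + j] ⟨x, hx⟩) :: w, by simp [hw], ?_⟩
      rw [DFA.evalFrom_cons, ← add_assoc, Function.iterate_succ_apply', ← e]
      exact congrArg (M.evalFrom · w) (ha _)
  obtain ⟨i, j, hij, e⟩ := Finite.exists_ne_map_eq_of_infinite fun i => f^[i] ⟨x, hx⟩
  wlog hlt : i < j generalizing i j
  · exact this j i hij.symm e.symm (by omega)
  obtain ⟨w, hw, e'⟩ := path i (j - i)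
  rw [show i + (j - i) = j by omega, ← show f^[i] ⟨x, hx⟩ = f^[j] ⟨x, hx⟩ from e] at e'
  refine ⟨_, (f^[i] ⟨x, hx⟩).2, w, ?_, e'⟩
  rintro rfl
  simp at hw
  omega

/-! ### The criterion -/

/-- The successor function `T` is compatible with the transitions on the complement of `l`: the
set accepted from `T q` is the set accepted from `q`, shifted by one. -/
def ShiftCompatible (M : DFA (Fin b) σ) (l : List σ) (T : σ → σ) (q : σ) : Prop :=
  T q ∉ l ∧ (∀ a a' : Fin b, (a' : ℕ) = a + 1 → M.step q a' = M.step (T q) a) ∧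
    ∀ z d : Fin b, (z : ℕ) = 0 → (d : ℕ) + 1 = b → T (M.step q z) = M.step (T q) d

/-- This is addition of one by hand: if the lowest digit of n is below b - 1 it is incremented;
otherwise it becomes 0 and the carry is the same claim for n / b at the successor by zero. -/
theorem mem_numbersFrom_of_shiftCompatible (h : ZeroStable M) (hb : 2 ≤ b) {l : List σ}
    (hl : Peeling M l) {T : σ → σ} (hT : ∀ q, q ∉ l → ShiftCompatible M l T q) (n : ℕ) {q : σ}
    (hq : q ∉ l) : n + 1 ∈ numbersFrom M q ↔ n ∈ numbersFrom M (T q) := by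
  induction n using Nat.strong_induction_on generalizing q with
  | _ n ih =>
    obtain ⟨_, h1, h2⟩ := hT q hq
    have hlt : n % b < b := Nat.mod_lt _ (by omega)
    have hn : n = n % b + b * (n / b) := (Nat.mod_add_div n b).symm
    by_cases hd : n % b + 1 < b
    · have e1 := h.add_mul_mem hb (q := q) ⟨n % b + 1, hd⟩ (n / b)
      have e2 := h.add_mul_mem hb (q := T q) ⟨n % b, hlt⟩ (n / b)
      rw [h1 ⟨n % b, hlt⟩ ⟨n % b + 1, hd⟩ rfl] at e1
      rw [← e1] at e2
      dsimp only at e2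
      rw [← hn, show n % b + 1 + b * (n / b) = n + 1 by omega] at e2
      exact e2.symm
    · have hd' : n % b + 1 = b := by omega
      have e1 := h.add_mul_mem hb (q := q) ⟨0, by omega⟩ (n / b + 1)
      have e2 := h.add_mul_mem hb (q := T q) ⟨n % b, hlt⟩ (n / b)
      rw [← h2 ⟨0, by omega⟩ ⟨n % b, hlt⟩ rfl hd'] at e2
      have hlt' : n / b < n := Nat.div_lt_self (by omega) (by omega)
      rw [ih _ hlt' fun hmem => hq (hl.mem_of_step_mem hmem), ← e2] at e1
      dsimp only at e1
      rw [← hn, mul_add, show 0 + (b * (n / b) + b * 1) = n + 1 by omega] at e1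
      exact e1

/-- Iterating the shift, n is accepted from q iff T^n q accepts 0, that is, is final; the orbit of q
under T is eventually periodic. -/
theorem ultimatelyPeriodic_of_shiftCompatible [Finite σ] (h : ZeroStable M) (hb : 2 ≤ b)
    {l : List σ} (hl : Peeling M l) {T : σ → σ} (hT : ∀ q, q ∉ l → ShiftCompatible M l T q)
    {q : σ} (hq : q ∉ l) : UltimatelyPeriodic (numbersFrom M q) := by
  have key : ∀ n, ∀ {q : σ}, q ∉ l → (n ∈ numbersFrom M q ↔ T^[n] q ∈ M.accept) := by
    intro n
    induction n with
    | zero => intro q _; exact h.zero_mem_numbersFrom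
    | succ n ih =>
      intro q hq
      rw [mem_numbersFrom_of_shiftCompatible h hb hl hT n hq, ih (hT q hq).1,
        Function.iterate_succ_apply]
  obtain ⟨i, j, hij, e⟩ := Finite.exists_ne_map_eq_of_infinite fun i => T^[i] q
  wlog hlt : i < j generalizing i j
  · exact this j i hij.symm e.symm (by omega)
  refine ⟨i, j - i, by omega, fun n hn => ?_⟩
  rw [key _ hq, key _ hq]
  have e1 : n + (j - i) = (n - i) + j := by omega
  have e2 : T^[n] q = T^[(n - i) + i] q := by rw [Nat.sub_add_cancel hn]
  rw [e1, e2, Function.iterate_add_apply, Function.iterate_add_apply,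
    show T^[i] q = T^[j] q from e]

/-- Appending a most significant zero does not change the value, and accessibility makes every state
the end of some word. -/
theorem AcceptsUPSet.zeroStable (hacc : ∀ q, ∃ w, M.eval w = q) (h : AcceptsUPSet M) :
    ZeroStable M := by
  intro q a ha
  obtain ⟨w, rfl⟩ := hacc q
  have e : wordValue (w ++ [a]) = wordValue w := by
    simp [wordValue, Nat.ofDigits_append, ha]
  have h1 := h.1 w
  have h2 := h.1 (w ++ [a])
  rw [e, ← h1] at h2
  rw [DFA.mem_accepts, DFA.mem_accepts, DFA.eval_append_singleton] at h2
  exact h2.symm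

theorem ZeroStable.acceptsUPSet_iff (h : ZeroStable M) :
    AcceptsUPSet M ↔ UltimatelyPeriodic (numbersFrom M M.start) :=
  ⟨fun H => H.2, fun H => ⟨fun _ => h.mem_acceptsFrom_iff, H⟩⟩

/-- The criterion that the program evaluates: `l` is a complete list of the states that no cycle
leads to, and `inv` inverts the digit zero on the other states. -/
theorem IsMinimalDFA.acceptsUPSet_iff [Finite σ] (hM : IsMinimalDFA M) (hb : 2 ≤ b) {l : List σ}
    (hl : Peeling M l) (hl' : ∀ q, q ∉ l → ∃ p a, p ∉ l ∧ M.step p a = q) {inv : σ → σ}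
    {z o : Fin b} (hz : (z : ℕ) = 0) (ho : (o : ℕ) = 1)
    (hinv : ∀ q, q ∉ l → inv (M.step q z) ∉ l ∧ M.step (inv (M.step q z)) z = M.step q z) :
    AcceptsUPSet M ↔ (∀ q, q ∈ M.accept ↔ M.step q z ∈ M.accept) ∧
      ∀ q, q ∉ l → ShiftCompatible M l (fun q => inv (M.step q o)) q := by
  have hzero : (∀ q, q ∈ M.accept ↔ M.step q z ∈ M.accept) ↔ ZeroStable M :=
    ⟨fun H q a ha => by rw [show a = z from Fin.ext (ha.trans hz.symm)]; exact H q,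
      fun H q => H q z hz⟩
  rw [hzero]
  constructor
  · intro H
    have h := H.zeroStable hM.1
    refine ⟨h, ?_⟩
    have hup : ∀ q, UltimatelyPeriodic (numbersFrom M q) := by
      intro q
      obtain ⟨w, rfl⟩ := hM.1 q
      exact h.ultimatelyPeriodic_evalFrom hb (h.acceptsUPSet_iff.1 H) w
    have hcyc : ∀ q, CoprimePeriodic M q → q ∉ l := by
      intro q hq
      obtain ⟨k, hk⟩ := hq.exists_replicate h hb hM.2 hz
      exact hl.notMem_of_onCycle ⟨_, by simp, hk⟩
    -- The unpeeled states that are not coprime periodic would be closed under choosing an unpeeled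
    -- predecessor, so one of them would lie on a cycle, where coprime periodicity holds.
    have hcp : ∀ q, q ∉ l → CoprimePeriodic M q := by
      by_contra! hne
      obtain ⟨q, ⟨-, hq⟩, hq'⟩ := exists_onCycle_of_forall_exists_pred (M := M)
        (S := {q | q ∉ l ∧ ¬ CoprimePeriodic M q}) hne (by
          rintro q ⟨hq, hq'⟩
          obtain ⟨p, a, hp, rfl⟩ := hl' q hq
          exact ⟨p, ⟨hp, fun hp' => hq' (hp'.step h hb a)⟩, a, rfl⟩)
      exact hq (h.coprimePeriodic_of_onCycle hb hq' (hup q))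
    have hT : ∀ q, q ∉ l → inv (M.step q o) ∉ l ∧
        ∀ n, (n ∈ numbersFrom M (inv (M.step q o)) ↔ n + 1 ∈ numbersFrom M q) := by
      intro q hq
      obtain ⟨w, hw⟩ := (hcp q hq).exists_succ h hb
      have ht : CoprimePeriodic M (M.evalFrom q w) := (hcp q hq).evalFrom h hb w
      -- Both sides accept n iff b n + 1 is accepted from q.
      have e : M.step (M.evalFrom q w) z = M.step q o := by
        apply h.numbersFrom_injective hM.2
        ext n
        rw [← h.add_mul_mem hb, hw, ← h.add_mul_mem hb, hz, ho, zero_add, add_comm]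
      obtain ⟨h1, h2⟩ := hinv _ (hcyc _ ht)
      rw [e] at h1 h2
      -- Only some unpeeled preimage under zero is known to be stored in `inv`; injectivity of zero
      -- makes it the shifted state.
      have e' : inv (M.step q o) = M.evalFrom q w :=
        (hcp _ h1).step_zero_injective h hb hM.2 ht hz (h2.trans e.symm)
      exact ⟨h1, by rw [e']; exact hw⟩
    intro q hq
    obtain ⟨h1, h2⟩ := hT q hq
    refine ⟨h1, fun a a' ha => ?_, fun z' d hz' hd => ?_⟩
    · apply h.numbersFrom_injective hM.2
      ext n
      rw [← h.add_mul_mem hb, ← h.add_mul_mem hb, h2, ha]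
      ring_nf
    · apply h.numbersFrom_injective hM.2
      ext n
      have hs : M.step q z' ∉ l := fun hmem => hq (hl.mem_of_step_mem hmem)
      rw [(hT _ hs).2, ← h.add_mul_mem hb, ← h.add_mul_mem hb, h2, hz']
      rw [show 0 + b * (n + 1) = (d : ℕ) + b * n + 1 by rw [mul_add]; omega]
  · rintro ⟨h, hT⟩
    rw [h.acceptsUPSet_iff]
    -- This direction uses neither minimality nor the choice of `inv`: any map satisfying the
    -- identities will do.
    exact hl.induction (P := fun q => UltimatelyPeriodic (numbersFrom M q))
      (fun q => h.ultimatelyPeriodic_of_step hb)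
      (fun q hq => ultimatelyPeriodic_of_shiftCompatible h hb hl hT hq) _

end

/-! ### Reasoning about programs -/

namespace RAM

@[simp]
theorem Store.setReg_reg (s : Store) (x v y : ℕ) :
    (s.setReg x v).reg y = if y = x then v else s.reg y := by
  simp [Store.setReg, Function.update_apply]

@[simp]
theorem Store.setReg_arr (s : Store) (x v : ℕ) : (s.setReg x v).arr = s.arr := rfl

@[simp]
theorem Store.setArr_reg (s : Store) (j i v : ℕ) : (s.setArr j i v).reg = s.reg := rfl

@[simp]
theorem Store.setArr_arr (s : Store) (j i v j' i' : ℕ) :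
    (s.setArr j i v).arr j' i' = if j' = j ∧ i' = i then v else s.arr j' i' := by
  by_cases hj : j' = j
  · subst hj; simp [Store.setArr, Function.update_apply]
  · simp [Store.setArr, hj]

/-- The program `P`, started in `s`, halts, and its result and its number of steps satisfy `K`. -/
def Runs (W : ℕ) (P : Prog) (s : Store) (K : Store → ℕ → Prop) : Prop :=
  ∃ s' t, Exec W P s s' t ∧ K s' t

section

variable {W : ℕ} {s : Store} {K : Store → ℕ → Prop}

theorem Runs.mono {P : Prog} {K' : Store → ℕ → Prop} (h : Runs W P s K)
    (hK : ∀ s' t, K s' t → K' s' t) : Runs W P s K' := by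
  obtain ⟨s', t, he, hk⟩ := h
  exact ⟨s', t, he, hK _ _ hk⟩

theorem runs_skip : Runs W .skip s K ↔ K s 0 := by
  constructor
  · rintro ⟨_, _, h, hk⟩; cases h; exact hk
  · exact fun h => ⟨_, _, .skip s, h⟩

theorem runs_instr {i : Instr} : Runs W (.instr i) s K ↔ ∃ s', i.run W s = some s' ∧ K s' 1 := by
  constructor
  · rintro ⟨_, _, h, hk⟩; cases h with | instr h => exact ⟨_, h, hk⟩
  · rintro ⟨s', h, hk⟩; exact ⟨_, _, .instr h, hk⟩

theorem runs_const {x k : ℕ} :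
    Runs W (.instr (.const x k)) s K ↔ k ≤ W ∧ K (s.setReg x k) 1 := by
  by_cases h : k ≤ W <;> simp [runs_instr, Instr.run, h]

theorem runs_copy {x y : ℕ} :
    Runs W (.instr (.copy x y)) s K ↔ K (s.setReg x (s.reg y)) 1 := by
  simp [runs_instr, Instr.run]

theorem runs_add {x y z : ℕ} : Runs W (.instr (.add x y z)) s K ↔
    s.reg y + s.reg z ≤ W ∧ K (s.setReg x (s.reg y + s.reg z)) 1 := by
  by_cases h : s.reg y + s.reg z ≤ W <;> simp [runs_instr, Instr.run, h]

theorem runs_sub {x y z : ℕ} :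
    Runs W (.instr (.sub x y z)) s K ↔ K (s.setReg x (s.reg y - s.reg z)) 1 := by
  simp [runs_instr, Instr.run]

theorem runs_load {x j y : ℕ} :
    Runs W (.instr (.load x j y)) s K ↔ K (s.setReg x (s.arr j (s.reg y))) 1 := by
  simp [runs_instr, Instr.run]

theorem runs_store {j x y : ℕ} :
    Runs W (.instr (.store j x y)) s K ↔ K (s.setArr j (s.reg x) (s.reg y)) 1 := by
  simp [runs_instr, Instr.run]

theorem runs_seq {P Q : Prog} : Runs W (.seq P Q) s K ↔
    Runs W P s fun s' t => Runs W Q s' fun s'' t' => K s'' (t + t') := by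
  constructor
  · rintro ⟨_, _, h, hk⟩
    cases h with | seq h h' => exact ⟨_, _, h, _, _, h', hk⟩
  · rintro ⟨_, _, h, _, _, h', hk⟩; exact ⟨_, _, .seq h h', hk⟩

theorem Runs.seq {P Q : Prog} {K' : Store → ℕ → Prop} (h : Runs W P s K')
    (h' : ∀ s' t, K' s' t → Runs W Q s' fun s'' t' => K s'' (t + t')) :
    Runs W (.seq P Q) s K :=
  runs_seq.2 (h.mono h')

theorem runs_ifLt {x y : ℕ} {P Q : Prog} : Runs W (.ifLt x y P Q) s K ↔
    if s.reg x < s.reg y then Runs W P s fun s' t => K s' (t + 1)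
    else Runs W Q s fun s' t => K s' (t + 1) := by
  split_ifs with h
  · constructor
    · rintro ⟨_, _, he, hk⟩
      cases he with
      | ifTrue _ hP => exact ⟨_, _, hP, hk⟩
      | ifFalse h' _ => exact absurd h h'
    · rintro ⟨_, _, he, hk⟩; exact ⟨_, _, .ifTrue h he, hk⟩
  · constructor
    · rintro ⟨_, _, he, hk⟩
      cases he with
      | ifTrue h' _ => exact absurd h' h
      | ifFalse _ hQ => exact ⟨_, _, hQ, hk⟩
    · rintro ⟨_, _, he, hk⟩; exact ⟨_, _, .ifFalse h he, hk⟩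

/-- The measure μ bounds the number of rounds: each costs at most c steps plus one test, and the
last failing test adds one. -/
theorem runs_whileLt {x y c : ℕ} {P : Prog} {Inv : Store → Prop} {μ : Store → ℕ}
    (hP : ∀ s, Inv s → s.reg x < s.reg y →
      Runs W P s fun s' t => Inv s' ∧ μ s' < μ s ∧ t ≤ c) (hs : Inv s) :
    Runs W (.whileLt x y P) s fun s' t =>
      Inv s' ∧ ¬ s'.reg x < s'.reg y ∧ t ≤ (c + 1) * μ s + 1 := by
  induction hm : μ s using Nat.strong_induction_on generalizing s with
  | _ m ih =>
    by_cases h : s.reg x < s.reg y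
    · obtain ⟨s', t, he, hs', hlt, ht⟩ := hP s hs h
      obtain ⟨s'', t', he', hs'', hn, ht'⟩ := ih _ (hm ▸ hlt) hs' rfl
      refine ⟨s'', _, .whileTrue h he he', hs'', hn, ?_⟩
      have : (c + 1) * (μ s' + 1) ≤ (c + 1) * m := Nat.mul_le_mul_left _ (by omega)
      rw [mul_add] at this
      omega
    · exact ⟨s, 1, .whileFalse h, hs, h, by omega⟩

/-- The programs `body 0, …, body (m - 1)`, in this order. -/
def forDigits (body : ℕ → Prog) : ℕ → Prog
  | 0 => .skip
  | m + 1 => .seq (forDigits body m) (body m)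

theorem runs_forDigits {body : ℕ → Prog} {c m : ℕ} {Inv : ℕ → Store → Prop}
    (h : ∀ k < m, ∀ s, Inv k s → Runs W (body k) s fun s' t => Inv (k + 1) s' ∧ t ≤ c)
    (hs : Inv 0 s) : Runs W (forDigits body m) s fun s' t => Inv m s' ∧ t ≤ c * m := by
  induction m with
  | zero => exact runs_skip.2 ⟨hs, by simp⟩
  | succ m ih =>
    refine (ih fun k hk => h k (by omega)).seq ?_
    rintro s' t ⟨hs', ht⟩
    refine (h m (by omega) s' hs').mono ?_
    rintro s'' t' ⟨hs'', ht'⟩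
    exact ⟨hs'', by rw [mul_add]; omega⟩

end

end RAM

/-! ### The memory during the computation -/

namespace RAM

section

variable {b n : ℕ} {M : DFA (Fin b) (Fin n)}

open Classical in
/-- The input is in place, and the registers `2` and `3` hold `0` and `1`. -/
structure HoldsInput (M : DFA (Fin b) (Fin n)) (s : Store) : Prop where
  size : s.reg 0 = n
  zero : s.reg 2 = 0
  one : s.reg 3 = 1
  step : ∀ (a : Fin b) (q : Fin n), s.arr a q = M.step q a
  accept : ∀ q : Fin n, s.arr b q = if q ∈ M.accept then 1 else 0

theorem HoldsInput.setReg {s : Store} (h : HoldsInput M s) {x : ℕ} (hx : 4 ≤ x) (v : ℕ) :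
    HoldsInput M (s.setReg x v) where
  size := by rw [Store.setReg_reg, if_neg (by omega), h.size]
  zero := by rw [Store.setReg_reg, if_neg (by omega), h.zero]
  one := by rw [Store.setReg_reg, if_neg (by omega), h.one]
  step := h.step
  accept := h.accept

theorem HoldsInput.setArr {s : Store} (h : HoldsInput M s) {j : ℕ} (hj : b < j) (i v : ℕ) :
    HoldsInput M (s.setArr j i v) where
  size := h.size
  zero := h.zero
  one := h.one
  step a q := by rw [Store.setArr_arr, if_neg (by omega), h.step]
  accept q := by rw [Store.setArr_arr, if_neg (by omega), h.accept]

theorem HoldsInput.step_nat {s : Store} (h : HoldsInput M s) {a : ℕ} (ha : a < b) (q : Fin n) :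
    s.arr a q = M.step q ⟨a, ha⟩ :=
  h.step ⟨a, ha⟩ q

/-- Run `body` for each state, in register `4`. -/
def forStates (body : Prog) : Prog :=
  .seq (.instr (.copy 4 2)) (.whileLt 4 0 (.seq body (.instr (.add 4 4 3))))

theorem runs_forStates {W c : ℕ} (hW : n ≤ W) {body : Prog} {Inv : ℕ → Store → Prop}
    (hInv : ∀ k s v, Inv k s → Inv k (s.setReg 4 v))
    (hbody : ∀ (q : Fin n) s, HoldsInput M s → s.reg 4 = q → Inv q s →
      Runs W body s fun s' t => HoldsInput M s' ∧ s'.reg 4 = q ∧ Inv (q + 1) s' ∧ t ≤ c)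
    {s : Store} (hs : HoldsInput M s) (h0 : Inv 0 s) :
    Runs W (forStates body) s fun s' t => HoldsInput M s' ∧ Inv n s' ∧ t ≤ (c + 2) * n + 2 := by
  rw [forStates, runs_seq, runs_copy]
  have key := runs_whileLt (W := W) (x := 4) (y := 0) (c := c + 1)
    (P := .seq body (.instr (.add 4 4 3)))
    (Inv := fun s => HoldsInput M s ∧ s.reg 4 ≤ n ∧ Inv (s.reg 4) s)
    (μ := fun s => n - s.reg 4) (s := s.setReg 4 (s.reg 2)) ?_ ?_
  · refine key.mono ?_
    rintro s' t ⟨⟨h1, h2, h3⟩, h4, h5⟩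
    rw [h1.size] at h4
    have e : s'.reg 4 = n := by omega
    rw [e] at h3
    refine ⟨h1, h3, ?_⟩
    have : (c + 1 + 1) * (n - (s.setReg 4 (s.reg 2)).reg 4) ≤ (c + 2) * n :=
      Nat.mul_le_mul_left _ (Nat.sub_le _ _)
    omega
  · rintro s ⟨h1, h2, h3⟩ h4
    rw [h1.size] at h4
    refine (hbody ⟨s.reg 4, h4⟩ s h1 rfl h3).seq ?_
    rintro s' t ⟨h1', h2', h3', h4'⟩
    dsimp only at h2' h3'
    rw [runs_add, h2', h1'.one]
    exact ⟨by omega, ⟨h1'.setReg le_rfl _, by simpa using h4, by simpa using hInv _ _ _ h3'⟩,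
      by simp; omega, by omega⟩
  · exact ⟨hs.setReg le_rfl _, by simp [hs.zero], by simpa [hs.zero] using hInv _ _ _ h0⟩

/-! ### Counting the incoming transitions -/

/-- The number of the transitions of `D` that lead to `q`. -/
def indegree (M : DFA (Fin b) (Fin n)) (D : Finset (Fin n × Fin b)) (q : Fin n) : ℕ :=
  (D.filter fun e => M.step e.1 e.2 = q).card

theorem indegree_insert {D : Finset (Fin n × Fin b)} {e : Fin n × Fin b} (he : e ∉ D)
    (q : Fin n) :
    indegree M (insert e D) q = indegree M D q + if M.step e.1 e.2 = q then 1 else 0 := by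
  unfold indegree
  rw [Finset.filter_insert]
  split_ifs
  · rw [Finset.card_insert_of_notMem (by simp [he])]
  · rfl

theorem indegree_le (D : Finset (Fin n × Fin b)) (q : Fin n) : indegree M D q ≤ b * n := by
  refine (Finset.card_le_univ _).trans ?_
  simp [mul_comm]

theorem indegree_eq_zero {D : Finset (Fin n × Fin b)} {q : Fin n} :
    indegree M D q = 0 ↔ ∀ p a, M.step p a = q → (p, a) ∉ D := by
  simp only [indegree, Finset.card_eq_zero, Finset.filter_eq_empty_iff, Prod.forall]
  exact ⟨fun h p a e hm => h p a hm e, fun h p a hm e => h p a e hm⟩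

/-- The array `b + 1` holds the indegrees. -/
def HoldsIndegree (M : DFA (Fin b) (Fin n)) (D : Finset (Fin n × Fin b)) (s : Store) : Prop :=
  ∀ q : Fin n, s.arr (b + 1) q = indegree M D q

/-- Count the incoming transitions of all states. -/
def countProg (b : ℕ) : Prog :=
  forStates (forDigits (fun a => .seq (.instr (.load 7 a 4)) (.seq (.instr (.load 8 (b + 1) 7))
    (.seq (.instr (.add 8 8 3)) (.instr (.store (b + 1) 7 8))))) b)

theorem runs_countProg {W : ℕ} (hW : n ≤ W) (hW' : b * n ≤ W) {s : Store}
    (hs : HoldsInput M s) (h0 : HoldsIndegree M ∅ s) (h6 : s.reg 6 = 0) :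
    Runs W (countProg b) s fun s' t => HoldsInput M s' ∧
      (HoldsIndegree M Finset.univ s' ∧ s'.reg 6 = 0 ∧ s'.reg 5 = s.reg 5 ∧
        s'.reg 10 = s.reg 10 ∧ s'.arr (b + 3) = s.arr (b + 3)) ∧ t ≤ (4 * b + 2) * n + 2 := by
  -- The transitions already counted when digit k of state i is due, in lexicographic order.
  set D : ℕ → ℕ → Finset (Fin n × Fin b) := fun i k =>
    Finset.univ.filter fun e => (e.1 : ℕ) < i ∨ (e.1 : ℕ) = i ∧ (e.2 : ℕ) < k with hD
  have key := runs_forStates (M := M) hW (c := 4 * b) (s := s)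
    (body := forDigits (fun a => .seq (.instr (.load 7 a 4)) (.seq (.instr (.load 8 (b + 1) 7))
    (.seq (.instr (.add 8 8 3)) (.instr (.store (b + 1) 7 8))))) b)
    (Inv := fun i s' => HoldsIndegree M (D i 0) s' ∧ s'.reg 6 = 0 ∧ s'.reg 5 = s.reg 5 ∧
        s'.reg 10 = s.reg 10 ∧ s'.arr (b + 3) = s.arr (b + 3)) ?_ ?_ hs ?_
  · have e : D n 0 = Finset.univ := by ext e; simp [hD]
    rw [e] at key
    exact key
  · rintro k s v ⟨h1, h2⟩
    exact ⟨h1, by simpa using h2⟩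
  · rintro q s' hs' h4 ⟨h1, h2⟩
    have key := runs_forDigits (W := W) (m := b) (c := 4) (s := s')
      (body := fun a => .seq (.instr (.load 7 a 4)) (.seq (.instr (.load 8 (b + 1) 7))
        (.seq (.instr (.add 8 8 3)) (.instr (.store (b + 1) 7 8)))))
      (Inv := fun k s' => HoldsInput M s' ∧ s'.reg 4 = q ∧ HoldsIndegree M (D q k) s' ∧
        s'.reg 6 = 0 ∧ s'.reg 5 = s.reg 5 ∧
        s'.reg 10 = s.reg 10 ∧ s'.arr (b + 3) = s.arr (b + 3)) ?_ ⟨hs', h4, h1, h2⟩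
    · refine key.mono ?_
      rintro s'' t ⟨⟨h1, h2, h3, h4⟩, ht⟩
      refine ⟨h1, h2, ⟨?_, h4⟩, by rwa [mul_comm] at ht ⊢⟩
      have e : D q b = D (q + 1) 0 := by
        ext e
        have := e.2.isLt
        simp only [hD, Finset.mem_filter, Finset.mem_univ, true_and]
        omega
      rwa [e] at h3
    · rintro k hk s'' ⟨h1, h2, h3, h4⟩
      simp only [runs_seq, runs_load, runs_add, runs_store]
      have e : D q (k + 1) = insert (q, ⟨k, hk⟩) (D q k) := by
        ext e
        simp only [hD, Finset.mem_filter, Finset.mem_univ, true_and, Finset.mem_insert,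
          Prod.ext_iff, Fin.ext_iff]
        omega
      have hn : (q, (⟨k, hk⟩ : Fin b)) ∉ D q k := by simp [hD]
      have hi := fun r => indegree_insert (M := M) hn r
      rw [← e] at hi
      have hr := hi (M.step q ⟨k, hk⟩)
      rw [if_pos rfl] at hr
      -- There are b n transitions in all, so the counter cannot overflow.
      have hle := indegree_le (M := M) (D q (k + 1)) (M.step q ⟨k, hk⟩)
      have h3' := fun r => h3 r
      simp only [Store.setReg_reg, Store.setReg_arr, h2, h1.step_nat hk, h1.one]
      norm_num
      simp only [h3']
      refine ⟨by omega, ⟨(((h1.setReg (by norm_num) _).setReg (by norm_num) _).setReg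
        (by norm_num) _).setArr (by omega) _ _, h2, ?_, h4.1, h4.2.1, h4.2.2.1, ?_⟩⟩
      · intro r
        rw [Store.setArr_arr, hi r]
        by_cases hrr : M.step q ⟨k, hk⟩ = r
        · subst hrr; simp
        · have : (r : ℕ) ≠ M.step q ⟨k, hk⟩ := fun h => hrr (Fin.ext h.symm)
          simp [this, hrr, h3']
      · rw [← h4.2.2.2]
        ext i
        simp
  · refine ⟨?_, h6, rfl, rfl, rfl⟩
    have e : D 0 0 = ∅ := by ext e; simp [hD]
    rwa [e]

/-! ### Peeling -/

/-- The list `l` is stored in the array `b + 2`, and its length in register `6`. -/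
def HoldsQueue (l : List (Fin n)) (b : ℕ) (s : Store) : Prop :=
  s.reg 6 = l.length ∧ ∀ (k : ℕ) (h : k < l.length), s.arr (b + 2) k = l[k]

/-- Append the content of register `x` to the queue. -/
def pushProg (b x : ℕ) : Prog :=
  .seq (.instr (.store (b + 2) 6 x)) (.instr (.add 6 6 3))

theorem runs_pushProg {W x : ℕ} {s : Store} {K : Store → ℕ → Prop} :
    Runs W (pushProg b x) s K ↔ s.reg 6 + s.reg 3 ≤ W ∧
      K ((s.setArr (b + 2) (s.reg 6) (s.reg x)).setReg 6 (s.reg 6 + s.reg 3)) 2 := by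
  simp [pushProg, runs_seq, runs_store, runs_add]

theorem HoldsQueue.push {l : List (Fin n)} {s : Store} (h : HoldsQueue l b s) (q : Fin n) :
    HoldsQueue (l ++ [q]) b ((s.setArr (b + 2) (s.reg 6) q).setReg 6 (s.reg 6 + 1)) := by
  refine ⟨by simp [h.1], fun k hk => ?_⟩
  simp only [List.length_append, List.length_singleton] at hk
  rw [Store.setReg_arr, Store.setArr_arr, h.1]
  by_cases e : k = l.length
  · subst e; simp
  · simp [e, List.getElem_append_left (show k < l.length by omega), h.2 k (by omega)]

theorem HoldsIndegree.push {D : Finset (Fin n × Fin b)} {s : Store}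
    (h : HoldsIndegree M D s) (i v w : ℕ) :
    HoldsIndegree M D ((s.setArr (b + 2) i v).setReg 6 w) := by
  intro q
  rw [← h q]
  simp

/-- The state of the peeling: the transitions of `D` are still to be removed, and the states
without incoming transitions are in the queue `l`. -/
structure IsPeeling (M : DFA (Fin b) (Fin n)) (l : List (Fin n)) (D : Finset (Fin n × Fin b))
    (s : Store) : Prop where
  input : HoldsInput M s
  indegree : HoldsIndegree M D s
  queue : HoldsQueue l b s
  peeling : Peeling M l
  mem_iff : ∀ q, q ∈ l ↔ RAM.indegree M D q = 0

/-- Queued states are distinct, so the queue length stays within the word size when a new state is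
appended. -/
theorem length_lt_of_notMem {l : List (Fin n)} (hl : Peeling M l) {q : Fin n} (hq : q ∉ l) :
    l.length < n := by
  have h : (q :: l).Nodup := List.nodup_cons.2 ⟨hq, hl.nodup⟩
  have := h.length_le_card
  simp at this
  omega

/-- Put the states without incoming transitions into the queue. -/
def sourcesProg (b : ℕ) : Prog :=
  forStates (.seq (.instr (.load 8 (b + 1) 4)) (.ifLt 2 8 .skip (pushProg b 4)))

theorem runs_sourcesProg {W : ℕ} (hW : n ≤ W) {s : Store} (hs : HoldsInput M s)
    (hi : HoldsIndegree M Finset.univ s) (h6 : s.reg 6 = 0) :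
    Runs W (sourcesProg b) s fun s' t =>
      ((∃ l, IsPeeling M l Finset.univ s') ∧ s'.reg 5 = s.reg 5 ∧
        s'.reg 10 = s.reg 10 ∧ s'.arr (b + 3) = s.arr (b + 3)) ∧ t ≤ 6 * n + 2 := by
  have key := runs_forStates (M := M) hW (c := 4) (s := s)
    (body := .seq (.instr (.load 8 (b + 1) 4)) (.ifLt 2 8 .skip (pushProg b 4)))
    (Inv := fun i s' => (∃ l, HoldsIndegree M Finset.univ s' ∧ HoldsQueue l b s' ∧ Peeling M l ∧
      ∀ q : Fin n, q ∈ l ↔ (q : ℕ) < i ∧ indegree M Finset.univ q = 0) ∧ s'.reg 5 = s.reg 5 ∧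
        s'.reg 10 = s.reg 10 ∧ s'.arr (b + 3) = s.arr (b + 3)) ?_ ?_ hs ?_
  · refine key.mono ?_
    rintro s' t ⟨h1, ⟨⟨l, h2, h3, h4, h5⟩, h6⟩, ht⟩
    exact ⟨⟨⟨l, h1, h2, h3, h4, fun q => by rw [h5 q]; simp⟩, h6⟩, ht⟩
  · rintro k s' v ⟨⟨l, h2, h3, h4⟩, h5⟩
    exact ⟨⟨l, h2, ⟨by simpa using h3.1, h3.2⟩, h4⟩, by simpa using h5⟩
  · rintro q s' hs' h4 ⟨⟨l, h1, h2, h3, h5⟩, h6⟩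
    rw [runs_seq, runs_load, runs_ifLt, h4, h1 q]
    have hs8 := hs'.setReg (x := 8) (by norm_num) (indegree M Finset.univ q)
    have hz : (s'.setReg 8 (indegree M Finset.univ q)).reg 2 = 0 := hs8.zero
    have h8 : (s'.setReg 8 (indegree M Finset.univ q)).reg 8 = indegree M Finset.univ q := by simp
    have hd8 : HoldsIndegree M Finset.univ (s'.setReg 8 (indegree M Finset.univ q)) := h1
    have hq8 : HoldsQueue l b (s'.setReg 8 (indegree M Finset.univ q)) :=
      ⟨by simpa using h2.1, h2.2⟩
    rw [hz, h8]
    split_ifs with hpos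
    · rw [runs_skip]
      refine ⟨hs8, by simpa using h4, ⟨⟨l, hd8, hq8, h3, fun r => ?_⟩, by simpa using h6⟩,
        by norm_num⟩
      rw [h5 r]
      constructor
      · rintro ⟨h, h'⟩; exact ⟨by omega, h'⟩
      · rintro ⟨h, h'⟩
        refine ⟨?_, h'⟩
        have : (r : ℕ) ≠ q := fun e => by rw [Fin.ext e] at h'; omega
        omega
    · have hq0 : indegree M Finset.univ q = 0 := by omega
      have hql : q ∉ l := fun h => by have := (h5 q).1 h; omega
      have hlt := length_lt_of_notMem h3 hql
      rw [runs_pushProg, hs8.one, show (s'.setReg 8 (indegree M Finset.univ q)).reg 4 = q by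
        simpa using h4]
      refine ⟨by rw [hq8.1]; omega, (hs8.setArr (by omega) _ _).setReg (by norm_num) _,
        by simpa using h4, ⟨⟨l ++ [q], hd8.push _ _ _, hq8.push q, ?_, fun r => ?_⟩, ?_⟩,
        by norm_num⟩
      · exact h3.snoc hql fun p a e => absurd (Finset.mem_univ _) (indegree_eq_zero.1 hq0 p a e)
      · rw [List.mem_append, List.mem_singleton, h5 r]
        constructor
        · rintro (⟨h, h'⟩ | rfl)
          · exact ⟨by omega, h'⟩
          · exact ⟨by omega, hq0⟩
        · rintro ⟨h, h'⟩
          by_cases e : r = q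
          · exact Or.inr e
          · have : (r : ℕ) ≠ q := fun e' => e (Fin.ext e')
            exact Or.inl ⟨by omega, h'⟩
      · refine ⟨by simpa using h6.1, by simpa using h6.2.1, ?_⟩
        rw [← h6.2.2]; ext i; simp
  · exact ⟨⟨[], hi, ⟨h6, by simp⟩, .nil, by simp⟩, rfl, rfl, rfl⟩

/-- Remove the transition by `a` from the state in register `7`. -/
def removeProg (b a : ℕ) : Prog :=
  .seq (.instr (.load 8 a 7)) (.seq (.instr (.load 9 (b + 1) 8)) (.seq (.instr (.sub 9 9 3))
    (.seq (.instr (.store (b + 1) 8 9)) (.ifLt 2 9 .skip (pushProg b 8)))))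

theorem runs_removeProg {W : ℕ} (hW : n ≤ W) {l : List (Fin n)} {D : Finset (Fin n × Fin b)}
    {p : Fin n} {a : ℕ} (ha : a < b) (hD : (p, ⟨a, ha⟩) ∉ D) {s : Store}
    (hs : IsPeeling M l (insert (p, ⟨a, ha⟩) D) s) (hl : ∀ e, e ∉ D → e.1 ∈ l)
    (h7 : s.reg 7 = p) :
    Runs W (removeProg b a) s fun s' t => ((∃ l', IsPeeling M (l ++ l') D s') ∧
      s'.reg 7 = p ∧ s'.reg 5 = s.reg 5 ∧ s'.reg 10 = s.reg 10 ∧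
        s'.arr (b + 3) = s.arr (b + 3)) ∧ t ≤ 7 := by
  obtain ⟨h1, h2, h3, h4, h5⟩ := hs
  set r := M.step p ⟨a, ha⟩ with hr
  have hi := indegree_insert (M := M) hD
  dsimp only at hi
  rw [← hr] at hi
  have hir := hi r
  rw [if_pos rfl] at hir
  simp only [removeProg, runs_seq, runs_load, runs_sub, runs_store]
  have h2' := fun q => h2 q
  simp only [Store.setReg_reg, Store.setReg_arr, h7, h1.step_nat ha, h1.one, ← hr]
  norm_num
  simp only [h2', hir, Nat.add_sub_cancel]
  set s' := (((s.setReg 8 r).setReg 9 (indegree M D r + 1)).setReg 9 (indegree M D r)).setArr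
    (b + 1) r (indegree M D r) with hs'
  have g1 : HoldsInput M s' := (((h1.setReg (by norm_num) _).setReg (by norm_num) _).setReg
        (by norm_num) _).setArr (by omega) _ _
  have g2 : HoldsIndegree M D s' := by
    intro r'
    rw [hs', Store.setArr_arr]
    by_cases hrr : r = r'
    · subst hrr; simp
    · have : (r' : ℕ) ≠ r := fun h => hrr (Fin.ext h.symm)
      have := hi r'
      simp_all [h2 r']
  have g3 : HoldsQueue l b s' := ⟨by simpa [hs'] using h3.1, fun k hk => by
    rw [← h3.2 k hk]; simp [hs']⟩
  have g7 : s'.reg 7 = p := by simpa [hs'] using h7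
  have g8 : s'.reg 8 = r := by simp [hs']
  have g9 : s'.reg 9 = indegree M D r := by simp [hs']
  have g5 : s'.reg 5 = s.reg 5 := by simp [hs']
  have g10 : s'.reg 10 = s.reg 10 := by simp [hs']
  have garr : s'.arr (b + 3) = s.arr (b + 3) := by ext i; simp [hs']
  clear_value s'
  rw [runs_ifLt, g1.zero, g9]
  have other : ∀ q, q ≠ r → (q ∈ l ↔ indegree M D q = 0) := by
    intro q hq
    rw [h5 q, hi q, if_neg hq.symm, add_zero]
  -- The transition being removed still leads to r, so r has not been queued; this excludes
  -- duplicates.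
  have hrl : r ∉ l := fun h => by have := (h5 r).1 h; omega
  split_ifs with hpos
  · rw [runs_skip]
    refine ⟨⟨⟨[], g1, g2, by simpa using g3, by simpa using h4, fun q => ?_⟩, g7, g5, g10, garr⟩,
      by norm_num⟩
    rw [List.append_nil]
    by_cases hq : q = r
    · subst hq
      exact ⟨fun h => absurd h hrl, fun h => by omega⟩
    · exact other q hq
  · have h0 : indegree M D r = 0 := by omega
    have hlt := length_lt_of_notMem h4 hrl
    rw [runs_pushProg, g1.one, g8]
    refine ⟨by rw [g3.1]; omega, ⟨⟨[r], (g1.setArr (by omega) _ _).setReg (by norm_num) _,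
      g2.push _ _ _, g3.push r, ?_, fun q => ?_⟩, ?_⟩, by norm_num⟩
    · exact h4.snoc hrl fun p a e => hl (p, a) (indegree_eq_zero.1 h0 p a e)
    · rw [List.mem_append, List.mem_singleton]
      by_cases hq : q = r
      · subst hq; simp [h0]
      · simp [hq, other q hq]
    · refine ⟨by simpa using g7, by simpa using g5, by simpa using g10, ?_⟩
      rw [← garr]; ext i; simp

/-- Peel off the states of the queue, and the states that become sources thereby. -/
def peelProg (b : ℕ) : Prog :=
  .whileLt 5 6 (.seq (.instr (.load 7 (b + 2) 5)) (.seq (.instr (.add 5 5 3))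
    (forDigits (removeProg b) b)))

theorem runs_peelProg {W : ℕ} (hW : n ≤ W) {s : Store}
    (hs : ∃ l, IsPeeling M l Finset.univ s) (h5 : s.reg 5 = 0) :
    Runs W (peelProg b) s fun s' t =>
      ((∃ l D, IsPeeling M l D s' ∧ ∀ e, e ∈ D ↔ e.1 ∉ l) ∧
        s'.reg 10 = s.reg 10 ∧ s'.arr (b + 3) = s.arr (b + 3)) ∧
      t ≤ (7 * b + 3) * n + 1 := by
  have key := runs_whileLt (W := W) (x := 5) (y := 6) (c := 7 * b + 2) (s := s)
    (P := .seq (.instr (.load 7 (b + 2) 5)) (.seq (.instr (.add 5 5 3))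
      (forDigits (removeProg b) b)))
    -- Here l is the processed part of the queue and l' the waiting part; D consists of the
    -- transitions whose source is not yet processed. Register 5 points to the head.
    (Inv := fun s' => (∃ l l' D, IsPeeling M (l ++ l') D s' ∧ (∀ e, e ∈ D ↔ e.1 ∉ l) ∧
      s'.reg 5 = l.length) ∧ s'.reg 10 = s.reg 10 ∧ s'.arr (b + 3) = s.arr (b + 3))
    (μ := fun s' => n - s'.reg 5) ?_ ?_
  · refine key.mono ?_
    rintro s' t ⟨⟨⟨l, l', D, h1, h2, h3⟩, h4⟩, h6, ht⟩
    rw [h3, h1.queue.1, List.length_append] at h6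
    have : l' = [] := List.length_eq_zero_iff.1 (by omega)
    subst this
    rw [List.append_nil] at h1
    exact ⟨⟨⟨l, D, h1, h2⟩, h4⟩, by simpa [h5] using ht⟩
  · rintro s' ⟨⟨l, l', D, h1, h2, h3⟩, h4⟩ h6
    rw [h3, h1.queue.1, List.length_append] at h6
    obtain _ | ⟨p, l'⟩ := l'
    · simp at h6
    have hnd := h1.peeling.nodup
    have hlen : l.length < n := by
      have := hnd.length_le_card
      simp at this
      omega
    have hpl : p ∉ l := fun h =>
      (List.nodup_append.1 hnd).2.2 p h p (by simp) rfl
    have hld : s'.arr (b + 2) (s'.reg 5) = p := by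
      rw [h3, h1.queue.2 l.length (by simp)]
      simp
    have hone : (s'.setReg 7 p).reg 3 = 1 := by simp [h1.input.one]
    have h57 : (s'.setReg 7 p).reg 5 = l.length := by simp [h3]
    rw [runs_seq, runs_load, runs_seq, runs_add, hld, hone, h57]
    refine ⟨by omega, ?_⟩
    set s₁ := (s'.setReg 7 p).setReg 5 (l.length + 1) with hs₁
    -- The transitions left after those of p by the digits below k have been removed.
    set E : ℕ → Finset (Fin n × Fin b) := fun k =>
      D.filter fun e => ¬ (e.1 = p ∧ (e.2 : ℕ) < k) with hE
    have hE0 : E 0 = D := by simp [hE]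
    have g1 : IsPeeling M (l ++ p :: l') (E 0) s₁ := by
      rw [hE0]
      refine ⟨(h1.input.setReg (by norm_num) _).setReg (by norm_num) _, h1.indegree,
        ⟨?_, h1.queue.2⟩, h1.peeling, h1.mem_iff⟩
      rw [← h1.queue.1]; simp [hs₁]
    have g4 : s₁.reg 10 = s.reg 10 ∧ s₁.arr (b + 3) = s.arr (b + 3) := by
      simpa [hs₁] using h4
    have g7 : s₁.reg 7 = p := by simp [hs₁]
    have g5 : s₁.reg 5 = l.length + 1 := by simp [hs₁]
    clear_value s₁
    refine (runs_forDigits (W := W) (m := b) (c := 7) (s := s₁) (body := removeProg b)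
      (Inv := fun k s' => (∃ l', IsPeeling M (l ++ p :: l') (E k) s') ∧ s'.reg 7 = p ∧
        s'.reg 5 = l.length + 1 ∧ s'.reg 10 = s.reg 10 ∧ s'.arr (b + 3) = s.arr (b + 3))
      ?_ ⟨⟨l', g1⟩, g7, g5, g4⟩).mono ?_
    · rintro k hk s₂ ⟨⟨l₂, f1⟩, f7, f5, f4⟩
      have hins : E k = insert (p, ⟨k, hk⟩) (E (k + 1)) := by
        ext e
        simp only [hE, Finset.mem_filter, Finset.mem_insert, Prod.ext_iff]
        by_cases hep : e.1 = p
        · have : e ∈ D := (h2 e).2 (hep ▸ hpl)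
          simp only [hep, this, true_and, Fin.ext_iff]
          omega
        · simp [hep]
      rw [hins] at f1
      refine (runs_removeProg hW hk (by simp [hE]) f1 ?_ f7).mono ?_
      · intro e he
        by_cases hep : e.1 = p
        · simp [hep]
        · have : e ∉ D := fun h => he (by simp [hE, h, hep])
          have : e.1 ∈ l := by by_contra hc; exact this ((h2 e).2 hc)
          simp [this]
      · rintro s₃ t ⟨⟨⟨l₃, e1⟩, e7, e5, e10, earr⟩, ht⟩
        exact ⟨⟨⟨l₂ ++ l₃, by simpa using e1⟩, e7, e5.trans f5, e10.trans f4.1,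
          earr.trans f4.2⟩, ht⟩
    · rintro s₂ t ⟨⟨⟨l₂, f1⟩, f7, f5, f4⟩, ht⟩
      refine ⟨⟨⟨l ++ [p], l₂, E b, by simpa using f1, fun e => ?_, by simpa using f5⟩, f4⟩, ?_,
        by omega⟩
      · have := e.2.isLt
        simp only [hE, Finset.mem_filter, h2 e, this, and_true, List.mem_append,
          List.mem_singleton, not_or]
      · rw [f5, h3]; omega
  · obtain ⟨l, h1⟩ := hs
    exact ⟨⟨[], l, Finset.univ, h1, by simp, h5⟩, rfl, rfl⟩

end

end RAM

/-! ### Inverting the digit zero, and checking the criterion -/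

namespace RAM

section

variable {b n : ℕ} {M : DFA (Fin b) (Fin n)}

/-- The array `b + 1` is positive exactly on the states that are not in `l`. -/
def HoldsRest (l : List (Fin n)) (b : ℕ) (s : Store) : Prop :=
  ∀ q : Fin n, 0 < s.arr (b + 1) q ↔ q ∉ l

/-- The array `b + 3` holds the function `f`. -/
def HoldsInverse (f : Fin n → Fin n) (b : ℕ) (s : Store) : Prop :=
  ∀ q : Fin n, s.arr (b + 3) q = f q

/-- Store each state that has not been peeled off at its successor by zero. -/
def inverseProg (b : ℕ) : Prog :=
  forStates (.seq (.instr (.load 8 (b + 1) 4)) (.ifLt 2 8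
    (.seq (.instr (.load 7 0 4)) (.instr (.store (b + 3) 7 4))) .skip))

/-- A later write may overwrite an earlier one, but every write to a cell is an unpeeled preimage of
that cell under zero, so no injectivity check is needed. -/
theorem runs_inverseProg {W : ℕ} (hW : n ≤ W) (hb : 0 < b) {l : List (Fin n)} {s : Store}
    (hs : HoldsInput M s) (hl : HoldsRest l b s) {f : Fin n → Fin n} (hf : HoldsInverse f b s) :
    Runs W (inverseProg b) s fun s' t => HoldsInput M s' ∧
      (HoldsRest l b s' ∧ s'.reg 10 = s.reg 10 ∧ ∃ f : Fin n → Fin n, HoldsInverse f b s' ∧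
        ∀ q, q ∉ l → f (M.step q ⟨0, hb⟩) ∉ l ∧
          M.step (f (M.step q ⟨0, hb⟩)) ⟨0, hb⟩ = M.step q ⟨0, hb⟩) ∧ t ≤ 6 * n + 2 := by
  have key := runs_forStates (M := M) hW (c := 4) (s := s)
    (body := .seq (.instr (.load 8 (b + 1) 4)) (.ifLt 2 8
      (.seq (.instr (.load 7 0 4)) (.instr (.store (b + 3) 7 4))) .skip))
    (Inv := fun i s' => HoldsRest l b s' ∧ s'.reg 10 = s.reg 10 ∧
      ∃ f : Fin n → Fin n, HoldsInverse f b s' ∧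
        ∀ q : Fin n, (q : ℕ) < i → q ∉ l → f (M.step q ⟨0, hb⟩) ∉ l ∧
          M.step (f (M.step q ⟨0, hb⟩)) ⟨0, hb⟩ = M.step q ⟨0, hb⟩) ?_ ?_ hs ?_
  · refine key.mono ?_
    rintro s' t ⟨h1, ⟨h2, h3, f, h4, h5⟩, ht⟩
    exact ⟨h1, ⟨h2, h3, f, h4, fun q => h5 q q.isLt⟩, ht⟩
  · rintro k s' v ⟨h2, h3, f, h4⟩
    exact ⟨h2, by simpa using h3, f, h4⟩
  · rintro q s' hs' h4 ⟨h1, h2, f, h3, h5⟩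
    have h0 : s'.arr 0 q = M.step q ⟨0, hb⟩ := hs'.step_nat hb q
    have hlt : ∀ r : Fin n, r ≤ q → r = q ∨ (r : ℕ) < q := fun r hr => eq_or_lt_of_le hr
    simp only [runs_seq, runs_load, runs_ifLt, runs_skip, runs_store, h4]
    norm_num [h4, hs'.zero, h1 q, h0]
    split_ifs with hq
    · exact ⟨hs'.setReg (by norm_num) _, h1, h2, f, h3, fun r hr hrl =>
        (hlt r hr).elim (fun e => absurd hq (e ▸ hrl)) fun h => h5 r h hrl⟩
    · refine ⟨((hs'.setReg (by norm_num) _).setReg (by norm_num) _).setArr (by omega) _ _,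
        fun r => by rw [← h1 r]; simp, h2,
          Function.update f (M.step q ⟨0, hb⟩) q, fun r => ?_, fun r hr hrl => ?_⟩
      · rw [Store.setArr_arr, Function.update_apply]
        by_cases e : r = M.step q ⟨0, hb⟩
        · simp [e]
        · have : (r : ℕ) ≠ M.step q ⟨0, hb⟩ := fun e' => e (Fin.ext e')
          simp [e, this, h3 r]
      · rw [Function.update_apply]
        split_ifs with e
        · exact ⟨hq, e.symm⟩
        · exact (hlt r hr).elim (fun e' => absurd (by rw [e']) e) fun h => h5 r h hrl
  · exact ⟨hl, rfl, f, hf, fun q h => absurd h (by omega)⟩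

open Classical in
/-- The memory while the state `i` is being checked: register `10` tells whether a violation of
the condition `c` was found. -/
structure IsChecking (M : DFA (Fin b) (Fin n)) (l : List (Fin n)) (f : Fin n → Fin n) (i : ℕ)
    (c : Prop) (s : Store) : Prop where
  input : HoldsInput M s
  rest : HoldsRest l b s
  inverse : HoldsInverse f b s
  state : s.reg 4 = i
  flag : s.reg 10 = if c then 0 else 1

section

variable {l : List (Fin n)} {f : Fin n → Fin n} {i : ℕ} {c : Prop} {s : Store}

theorem IsChecking.setReg (h : IsChecking M l f i c s) {x : ℕ} (hx : 5 ≤ x) (hx' : x ≠ 10)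
    (v : ℕ) : IsChecking M l f i c (s.setReg x v) where
  input := h.input.setReg (by omega) v
  rest := h.rest
  inverse := h.inverse
  state := by rw [Store.setReg_reg, if_neg (by omega), h.state]
  flag := by rw [Store.setReg_reg, if_neg (by omega), h.flag]

theorem IsChecking.congr (h : IsChecking M l f i c s) {c' : Prop} (e : c ↔ c') :
    IsChecking M l f i c' s := by
  rwa [← propext e]

theorem IsChecking.fail (h : IsChecking M l f i c s) {c' : Prop} (hc : ¬ c') :
    IsChecking M l f i c' (s.setReg 10 1) where
  input := h.input.setReg (by omega) 1
  rest := h.rest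
  inverse := h.inverse
  state := by rw [Store.setReg_reg, if_neg (by omega), h.state]
  flag := by rw [Store.setReg_reg, if_pos rfl, if_neg hc]

/-- Report a violation if the registers `x` and `y` are different. -/
def checkEqProg (x y : ℕ) : Prog :=
  .seq (.ifLt x y (.instr (.copy 10 3)) .skip) (.ifLt y x (.instr (.copy 10 3)) .skip)

theorem runs_checkEqProg {W x y : ℕ} (hx : x ≠ 10) (hy : y ≠ 10)
    (h : IsChecking M l f i c s) : Runs W (checkEqProg x y) s fun s' t =>
      (IsChecking M l f i (c ∧ s.reg x = s.reg y) s' ∧ s'.reg 7 = s.reg 7 ∧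
        s'.reg 11 = s.reg 11) ∧ t ≤ 4 := by
  simp only [checkEqProg, runs_seq, runs_ifLt, runs_copy, runs_skip, h.input.one]
  split_ifs with h1 h2 h3
  · simp only [Store.setReg_reg, if_neg hx, if_neg hy] at h2
    omega
  · exact ⟨⟨h.fail fun h => by omega, by simp, by simp⟩, by norm_num⟩
  · exact ⟨⟨h.fail fun h => by omega, by simp, by simp⟩, by norm_num⟩
  · exact ⟨⟨h.congr ⟨fun hc => ⟨hc, by omega⟩, fun h => h.1⟩, by simp⟩, by norm_num⟩

end

/-- Check whether register `4` and its successor by zero agree with regard to finality. -/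
def checkFinalProg (b : ℕ) : Prog :=
  .seq (.instr (.load 8 b 4)) (.seq (.instr (.load 7 0 4)) (.seq (.instr (.load 9 b 7))
    (checkEqProg 8 9)))

/-- Check whether register `11` is a state that has not been peeled off. -/
def checkRestProg (b : ℕ) : Prog :=
  .seq (.instr (.load 8 (b + 1) 11)) (.ifLt 2 8 .skip (.instr (.copy 10 3)))

/-- Check whether the successor of register `4` by `k + 1` is that of register `11` by `k`. -/
def checkDigitProg (k : ℕ) : Prog :=
  .seq (.instr (.load 8 (k + 1) 4)) (.seq (.instr (.load 9 k 11)) (checkEqProg 8 9))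

/-- Check the carry: register `7` holds the successor by zero of register `4`. -/
def checkCarryProg (b : ℕ) : Prog :=
  .seq (.instr (.load 8 1 7)) (.seq (.instr (.load 8 (b + 3) 8))
    (.seq (.instr (.load 9 (b - 1) 11)) (checkEqProg 8 9)))

section

variable {l : List (Fin n)} {f : Fin n → Fin n} {c : Prop} {s : Store} {q t : Fin n} {W : ℕ}

theorem runs_checkFinalProg (hb : 0 < b) (h : IsChecking M l f q c s) :
    Runs W (checkFinalProg b) s fun s' t =>
      (IsChecking M l f q (c ∧ (q ∈ M.accept ↔ M.step q ⟨0, hb⟩ ∈ M.accept)) s' ∧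
        s'.reg 7 = M.step q ⟨0, hb⟩) ∧ t ≤ 7 := by
  have h0 : s.arr 0 q = M.step q ⟨0, hb⟩ := h.input.step_nat hb q
  simp only [checkFinalProg, runs_seq, runs_load]
  simp only [Store.setReg_reg, Store.setReg_arr, h.state]
  norm_num [h.state, h0]
  have hc := ((h.setReg (x := 8) (by norm_num) (by norm_num) (s.arr b q)).setReg (x := 7)
    (by norm_num) (by norm_num) (M.step q ⟨0, hb⟩)).setReg (x := 9)
    (by norm_num) (by norm_num) (s.arr b (M.step q ⟨0, hb⟩))
  refine (runs_checkEqProg (W := W) (x := 8) (y := 9) (by norm_num) (by norm_num) hc).mono ?_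
  rintro s' t ⟨⟨h1, h2, -⟩, ht⟩
  refine ⟨⟨h1.congr (and_congr_right fun _ => ?_), by simpa using h2⟩, by omega⟩
  norm_num [h.input.accept]
  by_cases e1 : q ∈ M.accept <;> by_cases e2 : M.step q ⟨0, hb⟩ ∈ M.accept <;> simp [e1, e2]

theorem runs_checkRestProg (h : IsChecking M l f q c s) (h11 : s.reg 11 = t) :
    Runs W (checkRestProg b) s fun s' k =>
      (IsChecking M l f q (c ∧ t ∉ l) s' ∧ s'.reg 7 = s.reg 7 ∧ s'.reg 11 = t) ∧ k ≤ 3 := by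
  simp only [checkRestProg, runs_seq, runs_load, runs_ifLt, runs_skip, runs_copy, h11]
  norm_num [h.input.zero, h.input.one, h.rest t, h11]
  have hc := h.setReg (x := 8) (by norm_num) (by norm_num) (s.arr (b + 1) t)
  split_ifs with ht
  · exact hc.fail (by tauto)
  · exact hc.congr (by tauto)

theorem runs_checkDigitProg {k : ℕ} (hk : k + 1 < b) (h : IsChecking M l f q c s)
    (h11 : s.reg 11 = t) : Runs W (checkDigitProg k) s fun s' m =>
      (IsChecking M l f q (c ∧ M.step q ⟨k + 1, hk⟩ = M.step t ⟨k, by omega⟩) s' ∧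
        s'.reg 7 = s.reg 7 ∧ s'.reg 11 = t) ∧ m ≤ 6 := by
  have h1 := h.input.step_nat hk q
  have h2 := h.input.step_nat (show k < b by omega) t
  simp only [checkDigitProg, runs_seq, runs_load]
  norm_num [h.state, h11, h1, h2]
  have hc := (h.setReg (x := 8) (by norm_num) (by norm_num) (M.step q ⟨k + 1, hk⟩)).setReg
    (x := 9) (by norm_num) (by norm_num) (M.step t ⟨k, by omega⟩)
  refine (runs_checkEqProg (W := W) (x := 8) (y := 9) (by norm_num) (by norm_num) hc).mono ?_
  rintro s' m ⟨⟨h1, h2, h3⟩, ht⟩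
  refine ⟨⟨h1.congr (and_congr_right fun _ => ?_), by simpa using h2, by simpa [h11] using h3⟩,
    by omega⟩
  norm_num [Fin.ext_iff]

theorem runs_checkCarryProg (hb : 2 ≤ b) {z : Fin n} (h : IsChecking M l f q c s)
    (h11 : s.reg 11 = t) (h7 : s.reg 7 = z) : Runs W (checkCarryProg b) s fun s' m =>
      IsChecking M l f q (c ∧ f (M.step z ⟨1, hb⟩) = M.step t ⟨b - 1, by omega⟩) s' ∧
        m ≤ 7 := by
  have h1 := h.input.step_nat hb z
  have h2 := h.input.step_nat (show b - 1 < b by omega) t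
  have h3 : s.arr (b + 3) (M.step z ⟨1, hb⟩) = f (M.step z ⟨1, hb⟩) := h.inverse _
  simp only [checkCarryProg, runs_seq, runs_load]
  norm_num [h.state, h11, h7, h1, h2, h3]
  have hc := ((h.setReg (x := 8) (by norm_num) (by norm_num) (M.step z ⟨1, hb⟩)).setReg (x := 8)
    (by norm_num) (by norm_num) (f (M.step z ⟨1, hb⟩))).setReg
    (x := 9) (by norm_num) (by norm_num) (M.step t ⟨b - 1, by omega⟩)
  refine (runs_checkEqProg (W := W) (x := 8) (y := 9) (by norm_num) (by norm_num) hc).mono ?_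
  rintro s' m ⟨⟨h1, -⟩, ht⟩
  refine ⟨h1.congr (and_congr_right fun _ => ?_), by omega⟩
  norm_num [Fin.ext_iff]

/-- The quantifiers over digits become the b - 1 comparisons and the single carry test that the
program carries out. -/
theorem shiftCompatible_iff (hb : 2 ≤ b) {T : Fin n → Fin n} :
    ShiftCompatible M l T q ↔ T q ∉ l ∧
      (∀ k, ∀ hk : k < b - 1, M.step q ⟨k + 1, by omega⟩ = M.step (T q) ⟨k, by omega⟩) ∧
      T (M.step q ⟨0, by omega⟩) = M.step (T q) ⟨b - 1, by omega⟩ := by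
  refine and_congr_right fun _ => and_congr ⟨fun h k hk => h _ _ rfl, ?_⟩ ⟨fun h => h _ _ rfl ?_, ?_⟩
  · rintro h ⟨a, ha⟩ ⟨a', ha'⟩ rfl
    exact h a (by dsimp only at ha'; omega)
  · dsimp only; omega
  · rintro h ⟨z, hz⟩ ⟨d, hd⟩ rfl e
    obtain rfl : d = b - 1 := by dsimp only at e; omega
    exact h

/-- The condition that is checked for the state `q`. -/
def MeetsCriterion (M : DFA (Fin b) (Fin n)) (hb : 2 ≤ b) (l : List (Fin n))
    (f : Fin n → Fin n) (q : Fin n) : Prop :=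
  (q ∈ M.accept ↔ M.step q ⟨0, by omega⟩ ∈ M.accept) ∧
    (q ∉ l → ShiftCompatible M l (fun q => f (M.step q ⟨1, hb⟩)) q)

/-- The part of `checkProg` for one state. -/
def checkStateProg (b : ℕ) : Prog :=
  .seq (checkFinalProg b) (.seq (.instr (.load 8 (b + 1) 4)) (.ifLt 2 8
    (.seq (.instr (.load 11 1 4)) (.seq (.instr (.load 11 (b + 3) 11))
      (.seq (checkRestProg b) (.seq (forDigits checkDigitProg (b - 1)) (checkCarryProg b)))))
    .skip))

theorem runs_checkStateProg (hb : 2 ≤ b) (h : IsChecking M l f q c s) :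
    Runs W (checkStateProg b) s fun s' m =>
      IsChecking M l f q (c ∧ MeetsCriterion M hb l f q) s' ∧ m ≤ 6 * b + 21 := by
  refine (runs_checkFinalProg (by omega) h).seq ?_
  rintro s₁ m₁ ⟨⟨g1, g7⟩, hm₁⟩
  have h8 : s₁.arr (b + 1) (s₁.reg 4) = s₁.arr (b + 1) q := by rw [g1.state]
  rw [runs_seq, runs_load, runs_ifLt, h8]
  have g2 := g1.setReg (x := 8) (by norm_num) (by norm_num) (s₁.arr (b + 1) q)
  have g27 : (s₁.setReg 8 (s₁.arr (b + 1) q)).reg 7 = M.step q ⟨0, by omega⟩ := by simpa using g7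
  have hq : (s₁.setReg 8 (s₁.arr (b + 1) q)).reg 2 <
      (s₁.setReg 8 (s₁.arr (b + 1) q)).reg 8 ↔ q ∉ l := by
    rw [g2.input.zero, ← g1.rest q]; simp
  rw [if_congr hq rfl rfl]
  generalize s₁.setReg 8 (s₁.arr (b + 1) q) = s₂ at g2 g27
  split_ifs with hql
  swap
  · have h1 : s₂.arr 1 q = M.step q ⟨1, hb⟩ := g2.input.step_nat hb q
    have g3 := (g2.setReg (x := 11) (by norm_num) (by norm_num) (M.step q ⟨1, hb⟩)).setReg
      (x := 11) (by norm_num) (by norm_num) (f (M.step q ⟨1, hb⟩))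
    rw [runs_seq, runs_load, g2.state, h1, runs_seq, runs_load]
    simp only [Store.setReg_reg, Store.setReg_arr, if_true, g2.inverse (M.step q ⟨1, hb⟩)]
    have g37 : ((s₂.setReg 11 (M.step q ⟨1, hb⟩)).setReg 11 (f (M.step q ⟨1, hb⟩))).reg 7 =
      M.step q ⟨0, by omega⟩ := by simpa using g27
    have g311 : ((s₂.setReg 11 (M.step q ⟨1, hb⟩)).setReg 11 (f (M.step q ⟨1, hb⟩))).reg 11 =
      f (M.step q ⟨1, hb⟩) := by simp
    generalize (s₂.setReg 11 (M.step q ⟨1, hb⟩)).setReg 11 (f (M.step q ⟨1, hb⟩)) = s₃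
      at g3 g37 g311
    refine (runs_checkRestProg g3 g311).seq ?_
    rintro s₄ m₄ ⟨⟨g4, g47, g411⟩, hm₄⟩
    rw [g37] at g47
    refine Runs.seq (runs_forDigits (c := 6) (Inv := fun k s' =>
      IsChecking M l f q (((c ∧ (q ∈ M.accept ↔ M.step q ⟨0, by omega⟩ ∈ M.accept)) ∧
        f (M.step q ⟨1, hb⟩) ∉ l) ∧ ∀ j, ∀ hj : j < b - 1, j < k →
          M.step q ⟨j + 1, by omega⟩ = M.step (f (M.step q ⟨1, hb⟩)) ⟨j, by omega⟩) s' ∧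
        s'.reg 7 = M.step q ⟨0, by omega⟩ ∧ s'.reg 11 = f (M.step q ⟨1, hb⟩))
      ?_ ⟨g4.congr (by simp), g47, g411⟩) ?_
    · rintro k hk s' ⟨e1, e7, e11⟩
      refine (runs_checkDigitProg (by omega) e1 e11).mono ?_
      rintro s'' m ⟨⟨f1, f7, f11⟩, hm⟩
      refine ⟨⟨f1.congr ?_, f7.trans e7, f11⟩, hm⟩
      rw [and_assoc]
      refine and_congr_right fun _ => ⟨fun ⟨h, h'⟩ j hj hjk => ?_,
        fun h => ⟨fun j hj hjk => h j hj (by omega), h k hk (by omega)⟩⟩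
      rcases Nat.lt_succ_iff_lt_or_eq.1 hjk with hjk | rfl
      · exact h j hj hjk
      · exact h'
    · rintro s₅ m₅ ⟨⟨g5, g57, g511⟩, hm₅⟩
      refine (runs_checkCarryProg hb g5 g511 g57).mono ?_
      rintro s₆ m₆ ⟨g6, hm₆⟩
      refine ⟨g6.congr ?_, by omega⟩
      rw [MeetsCriterion, shiftCompatible_iff hb]
      simp only [hql, not_false_eq_true, true_implies, and_assoc]
      refine and_congr_right fun _ => and_congr_right fun _ => and_congr_right fun _ =>
        and_congr ⟨fun h k hk => h k hk hk, fun h k hk _ => h k hk⟩ Iff.rfl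
  · rw [runs_skip]
    refine ⟨g2.congr (and_congr_right fun _ => ?_), by omega⟩
    simp [MeetsCriterion, hql]

/-- Check the criterion for all states. -/
def checkProg (b : ℕ) : Prog :=
  forStates (checkStateProg b)

open Classical in
theorem runs_checkProg (hW : n ≤ W) (hb : 2 ≤ b) (hs : HoldsInput M s) (hl : HoldsRest l b s)
    (hf : HoldsInverse f b s) (h10 : s.reg 10 = 0) :
    Runs W (checkProg b) s fun s' m => HoldsInput M s' ∧
      s'.reg 10 = (if ∀ q, MeetsCriterion M hb l f q then 0 else 1) ∧
      m ≤ (6 * b + 23) * n + 2 := by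
  have key := runs_forStates (M := M) hW (c := 6 * b + 21) (s := s) (body := checkStateProg b)
    (Inv := fun i s' => HoldsRest l b s' ∧ HoldsInverse f b s' ∧
      s'.reg 10 = if ∀ q : Fin n, (q : ℕ) < i → MeetsCriterion M hb l f q then 0 else 1)
    ?_ ?_ hs ?_
  · refine key.mono ?_
    rintro s' m ⟨h1, ⟨-, -, h2⟩, hm⟩
    exact ⟨h1, by simpa using h2, hm⟩
  · rintro k s' v ⟨h1, h2, h3⟩
    exact ⟨h1, h2, by simpa using h3⟩
  · rintro q s' hs' h4 ⟨h1, h2, h3⟩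
    refine (runs_checkStateProg hb ⟨hs', h1, h2, h4, by convert h3⟩).mono ?_
    rintro s'' m ⟨g, hm⟩
    have e : (∀ r : Fin n, (r : ℕ) < q + 1 → MeetsCriterion M hb l f r) ↔
        (∀ r : Fin n, (r : ℕ) < q → MeetsCriterion M hb l f r) ∧ MeetsCriterion M hb l f q := by
      refine ⟨fun h => ⟨fun r hr => h r (by omega), h q (by omega)⟩, fun ⟨h, h'⟩ r hr => ?_⟩
      rcases Nat.lt_succ_iff_lt_or_eq.1 hr with hr | hr
      · exact h r hr
      · exact Fin.ext hr ▸ h'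
    exact ⟨g.input, g.state, ⟨g.rest, g.inverse, by rw [if_congr e rfl rfl]; convert g.flag⟩, hm⟩
  · exact ⟨hl, hf, by simp [h10]⟩

end

/-! ### The whole program -/

/-- The decision procedure for the base `b`. -/
def decideProg (b : ℕ) : Prog :=
  .seq (.instr (.const 3 1)) (.seq (countProg b) (.seq (sourcesProg b) (.seq (peelProg b)
    (.seq (inverseProg b) (.seq (checkProg b) (.instr (.sub 0 3 10)))))))

open Classical in
theorem runs_decideProg (hb : 2 ≤ b) (hM : IsMinimalDFA M) :
    Runs ((17 * b + 60) * n) (decideProg b) (input M) fun s t =>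
      t ≤ (17 * b + 60) * n ∧ s.reg 0 = if AcceptsUPSet M then 1 else 0 := by
  -- The initial state forces n ≥ 1, so multiples of n can absorb the additive constants.
  have hn : 0 < n := M.start.pos
  have hW : n ≤ (17 * b + 60) * n := Nat.le_mul_of_pos_left n (by omega)
  have hW' : b * n ≤ (17 * b + 60) * n := Nat.mul_le_mul_right n (by omega)
  rw [decideProg, runs_seq, runs_const]
  refine ⟨by omega, ?_⟩
  have hin : HoldsInput M ((input M).setReg 3 1) := by
    refine ⟨?_, ?_, ?_, fun a q => ?_, fun q => ?_⟩
    · simp [input]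
    · simp [input]
    · simp
    · simp [input]
    · simp [input]
  refine (runs_countProg hW hW' hin (fun q => ?_) ?_).seq ?_
  · simp [input, indegree]
  · simp [input]
  rintro s₁ t₁ ⟨h1, ⟨d1, g16, g15, g110, g1a⟩, ht₁⟩
  refine (runs_sourcesProg hW h1 d1 g16).seq ?_
  rintro s₂ t₂ ⟨⟨h2, g25, g210, g2a⟩, ht₂⟩
  refine (runs_peelProg hW h2 ?_).seq ?_
  · rw [g25, g15]; simp [input]
  rintro s₃ t₃ ⟨⟨⟨l, D, h3, hD⟩, g310, g3a⟩, ht₃⟩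
  -- After the peeling the remaining indegrees double as a membership table: zero exactly on the
  -- peeled states.
  have hrest : HoldsRest l b s₃ := fun q => by
    rw [h3.indegree q, h3.mem_iff, Nat.pos_iff_ne_zero]
  -- Untouched cells hold 0, which is a state because n > 0. This default is harmless: the criterion
  -- constrains `inv` only at successors by zero of unpeeled states.
  have hf0 : HoldsInverse (fun _ => (⟨0, hn⟩ : Fin n)) b s₃ := fun q => by
    rw [g3a, g2a, g1a]; simp [input]
  refine (runs_inverseProg hW (by omega) h3.input hrest hf0).seq ?_
  rintro s₄ t₄ ⟨h4, ⟨hrest', g410, f, hf, hinv⟩, ht₄⟩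
  have h10 : s₄.reg 10 = 0 := by
    rw [g410, g310, g210, g110]; simp [input]
  refine (runs_checkProg hW hb h4 hrest' hf h10).seq ?_
  rintro s₅ t₅ ⟨h5, g5, ht₅⟩
  rw [runs_sub]
  refine ⟨?_, ?_⟩
  · have : (17 * b + 60) * n = (4 * b + 2) * n + 6 * n + (7 * b + 3) * n + 6 * n +
      (6 * b + 23) * n + 20 * n := by ring
    omega
  · have key := hM.acceptsUPSet_iff hb h3.peeling (fun q hq => ?_) (z := ⟨0, by omega⟩)
      (o := ⟨1, hb⟩) rfl rfl hinv
    · rw [Store.setReg_reg, if_pos rfl, h5.one, g5, if_congr key rfl rfl]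
      simp only [MeetsCriterion, forall_and]
      split_ifs <;> rfl
    -- An unpeeled state keeps an incoming transition in D, and the sources of the transitions in D
    -- are unpeeled: the peeling is complete.
    · rw [h3.mem_iff, indegree_eq_zero] at hq
      push Not at hq
      obtain ⟨p, a, e, hmem⟩ := hq
      exact ⟨p, a, (hD _).1 hmem, e⟩

end

end RAM

/-- For each fixed base `b ≥ 2` there are one program and one constant `C` such that, on every
minimal automaton over the digits of base `b` with `n` states, the program halts within `C * n`
steps, on words bounded by `C * n`, and register `0` then tells whether the automaton accepts an
ultimately periodic set of numbers. -/
theorem theoremt (b : ℕ) (hb : 2 ≤ b) :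
    ∃ (P : RAM.Prog) (C : ℕ), ∀ (n : ℕ) (M : DFA (Fin b) (Fin n)), IsMinimalDFA M →
      ∃ (s : RAM.Store) (t : ℕ), RAM.Exec (C * n) P (RAM.input M) s t ∧ t ≤ C * n ∧
        s.reg 0 = (open Classical in if AcceptsUPSet M then 1 else 0) :=
  ⟨RAM.decideProg b, 17 * b + 60, fun _ _ hM => RAM.runs_decideProg hb hM⟩
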